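/- Let $\mathsf{BA}$ be the category of Boolean algebras, presented by a finitary signature $\Sigma_{BA}$ and equations $E_{BA}$, i.e. $\mathsf{BA}=\mathrm{Alg}(\Sigma_{BA},E_{BA})$ concretely over $\mathsf{Set}$. Let $P$ be the contravariant powerset functor $\mathsf{Set}\to\mathsf{BA}$ and $T:\mathsf{Set}\to\mathsf{Set}$ any functor. *Abstract logics.* An abstract logic $(L,\delta)$ for $T$-coalgebras is a sifted-colimit-preserving functor $L:\mathsf{BA}\to\mathsf{BA}$ with a natural transformation $\delta:LP\to PT$. A coalgebra $(X,\xi)$ gives the $L$-algebra $\tilde P(X,\xi)=(PX,\,P\xi\circ\delta_X)$. Given a left adjoint $F^a$ of the forgetful functor $U^a:\mathrm{Alg}(L)\to\mathsf{Set}$ and a valuation $h:V\to 2^X$, the abstract semantics $[\![-]\!]^{\mathrm{abs}}_{(X,\xi,h)}:F^aV\to\tilde P(X,\xi)$ is the unique $L$-algebra morphism extending $h$. *Concrete logics.* A concrete logic $(\Sigma,E,\Delta)$ for $T$-coalgebras consists of a set $\Sigma$ of modal operators with finite arities; a set $E$ of equations of rank 1 in some set of variables (both sides are $\Sigma_{BA}$-terms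 in expressions $\heartsuit(t_1,\dots,t_n)$ with $\heartsuit\in\Sigma$ and $t_i$ $\Sigma_{BA}$-terms in the variables); and, for each $n$-ary $\heartsuit\in\Sigma$, a predicate lifting, that is, a natural transformation $[\![\heartsuit]\!]_X:(2^X)^n\to 2^{TX}$. The equations must be sound: for all sets $X$ and all valuations of the variables in $2^X$, both sides have the same value in $2^{TX}$, where the inner $\Sigma_{BA}$-terms are evaluated in $PX$, the modal operators by $\Delta$, and the outer $\Sigma_{BA}$-terms in $PTX$. Formulas over a set $V$ are the terms over $\Sigma_{BA}+\Sigma$ with variables in $V$. Their concrete semantics $[\![\phi]\!]^{\mathrm{conc}}_{(X,\xi,h)}\subseteq X$ is defined by recursion, Boolean operations being set-theoretic and $[\![\heartsuit(\phi_1,\dots,\phi_n)]\!]^{\mathrm{conc}}=\xi^{-1}\big([\![\heartsuit]\!]_X([\![\phi_1]\!]^{\mathrm{conc}},\dots,[\![\phi_n]\!]^{\mathrm{conc}})\big)$. Let $F^cV$ be the set of formulas over $V$ modulo equational derivability from $E_{BA}+E$ (the free $(\Sigma_{BA}+\Sigma,E_{BA}+E)$-algebra), and $[\phi]\in F^cV$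 the class of $\phi$. *Equivalence.* Call $(L,\delta)$ and $(\Sigma,E,\Delta)$ equivalent if there is a concrete isomorphism $g:\mathrm{Alg}(L)\to\mathrm{Alg}(\Sigma_{BA}+\Sigma,E_{BA}+E)$ (an isomorphism of categories commuting with the forgetful functors to $\mathsf{Set}$) such that 1. for every left adjoint $F^a$ of $U^a$ there are isomorphisms $f:F^cV\to g(F^aV)$ for all sets $V$, compatible with the inclusions of $V$, such that $[\![f[\phi]]\!]^{\mathrm{abs}}_{(X,\xi,h)}=[\![\phi]\!]^{\mathrm{conc}}_{(X,\xi,h)}$ for all $V$, all coalgebras $(X,\xi)$, all $h:V\to 2^X$ and all formulas $\phi$ over $V$; and 2. a left adjoint $F^a$ of $U^a$ exists and can be chosen with $g(F^aV)=F^cV$ for all sets $V$, with unit $v\mapsto[v]$, and $[\![[\phi]]\!]^{\mathrm{abs}}_{(X,\xi,h)}=[\![\phi]\!]^{\mathrm{conc}}_{(X,\xi,h)}$ for all such $V,(X,\xi),h,\phi$. **Theorem.** For each abstract logic there is an equivalent concrete logic, and for each concrete logic there is an equivalent abstract logic. -/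

import Mathlib

universe u

namespace CoalgLogic

open CategoryTheory Limits Opposite

/-! ### Finitary universal algebra -/

/-- A finitary one-sorted signature: a set of operation symbols, each with a finite arity. -/
structure Sig where
  ops : Type u
  ar : ops → ℕ

/-- Disjoint union of signatures. -/
def Sig.sum (S S' : Sig.{u}) : Sig.{u} where
  ops := S.ops ⊕ S'.ops
  ar := Sum.elim S.ar S'.ar

/-- Terms over a signature with variables in `V`. -/
inductive Term (S : Sig.{u}) (V : Type u) : Type u
  | var (v : V) : Term S V
  | op (o : S.ops) (ts : Fin (S.ar o) → Term S V) : Term S V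

/-- An interpretation of the operation symbols of `S` on a set `A`. -/
def Str (S : Sig.{u}) (A : Type u) : Type u :=
  ∀ o : S.ops, (Fin (S.ar o) → A) → A

/-- The value of a term under a valuation of its variables. -/
def Term.eval {S : Sig.{u}} {A V : Type u} (s : Str S A) (h : V → A) : Term S V → A
  | .var v => h v
  | .op o ts => s o fun i => (ts i).eval s h

/-- The term structure on the set of terms. -/
def termStr (S : Sig.{u}) (V : Type u) : Str S (Term S V) :=
  fun o ts => .op o ts

/-- Simultaneous substitution. -/
def Term.subst {S : Sig.{u}} {V W : Type u} (σ : V → Term S W) (t : Term S V) : Term S W :=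
  t.eval (termStr S W) σ

/-- Terms over `S` seen as terms over `S + S'`, with variables substituted along `σ`. -/
def Term.inl {S S' : Sig.{u}} {V W : Type u} (σ : V → Term (S.sum S') W) (t : Term S V) :
    Term (S.sum S') W :=
  t.eval (fun o ts => .op (S := S.sum S') (Sum.inl o) ts) σ

/-- A map is a homomorphism if it commutes with all operations. -/
def IsHom {S : Sig.{u}} {A B : Type u} (s : Str S A) (s' : Str S B) (f : A → B) : Prop :=
  ∀ (o : S.ops) (a : Fin (S.ar o) → A), f (s o a) = s' o fun i => f (a i)

/-- A signature together with a set of equations in a set of variables. -/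
structure Theory where
  sig : Sig.{u}
  Var : Type u
  eqs : Set (Term sig Var × Term sig Var)

/-- The structure satisfies all equations of the theory under all valuations. -/
def Theory.Sat (E : Theory.{u}) {A : Type u} (s : Str E.sig A) : Prop :=
  ∀ e ∈ E.eqs, ∀ h : E.Var → A, e.1.eval s h = e.2.eval s h

/-- The algebras for a theory `(Σ, E)`, i.e. the objects of `Alg(Σ, E)`. -/
structure Alg (E : Theory.{u}) where
  carrier : Type u
  str : Str E.sig carrier
  sat : E.Sat str

/-- Homomorphisms of `(Σ, E)`-algebras. -/
@[ext]
structure Alg.Hom {E : Theory.{u}} (A B : Alg E) where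
  toFun : A.carrier → B.carrier
  isHom : IsHom A.str B.str toFun

instance (E : Theory.{u}) : Category (Alg E) where
  Hom A B := Alg.Hom A B
  id A := ⟨id, fun _ _ => rfl⟩
  comp f g := ⟨g.toFun ∘ f.toFun, fun o a =>
    (congrArg g.toFun (f.isHom o a)).trans (g.isHom o _)⟩

/-- The forgetful functor `Alg(Σ, E) → Set`. -/
def Alg.forget (E : Theory.{u}) : Alg E ⥤ Type u where
  obj A := A.carrier
  map f := TypeCat.ofHom f.toFun

/-- Derivability of equations from a theory in equational logic. -/
inductive Theory.Derives (E : Theory.{u}) (V : Type u) : Term E.sig V → Term E.sig V → Prop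
  | ax (e : Term E.sig E.Var × Term E.sig E.Var) (he : e ∈ E.eqs) (σ : E.Var → Term E.sig V) :
      Theory.Derives E V (e.1.subst σ) (e.2.subst σ)
  | refl (t : Term E.sig V) : Theory.Derives E V t t
  | symm {s t : Term E.sig V} : Theory.Derives E V s t → Theory.Derives E V t s
  | trans {s t r : Term E.sig V} :
      Theory.Derives E V s t → Theory.Derives E V t r → Theory.Derives E V s r
  | congr (o : E.sig.ops) (s t : Fin (E.sig.ar o) → Term E.sig V) :
      (∀ i, Theory.Derives E V (s i) (t i)) → Theory.Derives E V (.op o s) (.op o t)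

/-- The set of terms with variables in `V`, modulo derivable equality. -/
def Theory.termSetoid (E : Theory.{u}) (V : Type u) : Setoid (Term E.sig V) where
  r := E.Derives V
  iseqv := ⟨.refl, .symm, .trans⟩

/-- The operations on equivalence classes of terms (computed on representatives). -/
noncomputable def Theory.freeStr (E : Theory.{u}) (V : Type u) :
    Str E.sig (Quotient (E.termSetoid V)) :=
  fun o a => Quotient.mk (E.termSetoid V) (.op o fun i => (a i).out)

theorem Theory.freeStr_mk (E : Theory.{u}) (V : Type u) (o : E.sig.ops)
    (ts : Fin (E.sig.ar o) → Term E.sig V) :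
    E.freeStr V o (fun i => Quotient.mk (E.termSetoid V) (ts i)) =
      Quotient.mk (E.termSetoid V) (.op o ts) :=
  Quotient.sound (s := E.termSetoid V) (.congr o _ _ fun _ =>
    Quotient.exact (s := E.termSetoid V) (Quotient.out_eq _))

theorem Theory.eval_freeStr (E : Theory.{u}) {V W : Type u} (σ : W → Term E.sig V)
    (t : Term E.sig W) :
    t.eval (E.freeStr V) (fun w => Quotient.mk (E.termSetoid V) (σ w)) =
      Quotient.mk (E.termSetoid V) (t.subst σ) := by
  induction t with
  | var v => rfl
  | op o ts ih =>
    simp only [Term.eval, ih, E.freeStr_mk]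
    rfl

/-- The free `(Σ, E)`-algebra over `V`: terms modulo derivable equality. -/
noncomputable def Theory.free (E : Theory.{u}) (V : Type u) : Alg E where
  carrier := Quotient (E.termSetoid V)
  str := E.freeStr V
  sat := by
    intro e he h
    have hh : h = fun w => Quotient.mk (E.termSetoid V) ((h w).out) := by
      funext w
      exact (Quotient.out_eq (h w)).symm
    rw [hh, E.eval_freeStr, E.eval_freeStr]
    exact Quotient.sound (s := E.termSetoid V) (.ax e he _)

/-- The class `[t]` of a term in the free algebra. -/
def Theory.cls (E : Theory.{u}) {V : Type u} (t : Term E.sig V) : (E.free V).carrier :=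
  Quotient.mk (E.termSetoid V) t

/-! ### Concrete isomorphisms -/

/-- A concrete isomorphism between categories `U : C ⥤ Set` and `U' : D ⥤ Set` over `Set`: an
isomorphism of categories that commutes with the forgetful functors. -/
structure ConcreteIso {C D : Type (u + 1)} [Category.{u} C] [Category.{u} D]
    (U : C ⥤ Type u) (U' : D ⥤ Type u) where
  functor : C ⥤ D
  inverse : D ⥤ C
  functor_inverse : functor ⋙ inverse = 𝟭 C
  inverse_functor : inverse ⋙ functor = 𝟭 D
  functor_forget : functor ⋙ U' = U

/-- The identity map between the (equal) underlying sets of `g(A)` and `A`. -/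
def ConcreteIso.carrier {C D : Type (u + 1)} [Category.{u} C] [Category.{u} D]
    {U : C ⥤ Type u} {U' : D ⥤ Type u} (g : ConcreteIso U U') (A : C) :
    U'.obj (g.functor.obj A) → U.obj A :=
  cast (Functor.congr_obj g.functor_forget A)

/-! ### Boolean algebras -/

/-- A presentation of Boolean algebras by operations and equations, `BA = Alg(Σ_BA, E_BA)`:
the Boolean algebra structures on any set are in bijection with the structures for the signature
that satisfy the equations, and the homomorphisms are the same maps. -/
structure BAPresentation extends Theory.{u} where
  /-- structures on a fixed set -/
  equiv (A : Type u) : BooleanAlgebra A ≃ {s : Str sig A // toTheory.Sat s}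
  /-- the two notions of homomorphism agree -/
  hom_iff (A B : Type u) (a : BooleanAlgebra A) (b : BooleanAlgebra B) (f : A → B) :
    (∃ g : BoundedLatticeHom A B, ⇑g = f) ↔ IsHom (equiv A a).1 (equiv B b).1 f

/-- The interpretation of the operation symbols from `Σ_BA` in a Boolean algebra. -/
def BAPresentation.str (B : BAPresentation.{u}) (A : Type u) [a : BooleanAlgebra A] :
    Str B.sig A :=
  (B.equiv A a).1

/-- The contravariant powerset functor `P : Set → BA`. -/
def powerset : (Type u)ᵒᵖ ⥤ BoolAlg.{u} where
  obj X := BoolAlg.of (Set X.unop)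
  map f := BoolAlg.ofHom
    { toFun := fun s => f.unop ⁻¹' s
      map_sup' := fun _ _ => rfl
      map_inf' := fun _ _ => rfl
      map_top' := rfl
      map_bot' := rfl }

/-! ### Abstract logics -/

/-- An abstract logic `(L, δ)` for `T`-coalgebras over Boolean algebras: a sifted colimit
preserving functor `L : BA → BA` and a natural transformation `δ : LP → PT`. -/
structure AbstractLogic (T : Type u ⥤ Type u) where
  L : BoolAlg.{u} ⥤ BoolAlg.{u}
  sifted : ∀ (J : Type u) [SmallCategory J] [IsSifted J], PreservesColimitsOfShape J L
  δ : powerset ⋙ L ⟶ T.op ⋙ powerset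

namespace AbstractLogic

variable {T : Type u ⥤ Type u} (𝓐 : AbstractLogic T)

/-- The forgetful functor `Uᵃ : Alg(L) → Set`. -/
abbrev forget : Endofunctor.Algebra 𝓐.L ⥤ Type u :=
  Endofunctor.Algebra.forget 𝓐.L ⋙ CategoryTheory.forget BoolAlg

/-- The `L`-algebra `Pξ ∘ δ_X : LPX → PTX → PX` of a `T`-coalgebra `(X, ξ)`. -/
def tildeP (X : Endofunctor.Coalgebra T) : Endofunctor.Algebra 𝓐.L where
  a := powerset.obj (op X.V)
  str := 𝓐.δ.app (op X.V) ≫ powerset.map X.str.op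

/-- The abstract semantics: the map underlying the unique `L`-algebra morphism from the free
`L`-algebra `Fᵃ V` to the algebra of the coalgebra that extends the valuation `h`. -/
def sem {Fa : Type u ⥤ Endofunctor.Algebra 𝓐.L} (adj : Fa ⊣ 𝓐.forget)
    (X : Endofunctor.Coalgebra T) {V : Type u} (h : V → Set X.V) :
    𝓐.forget.obj (Fa.obj V) → Set X.V :=
  𝓐.forget.map ((adj.homEquiv V (𝓐.tildeP X)).symm (TypeCat.ofHom h))

end AbstractLogic

/-! ### Concrete logics -/

/-- Terms of rank 1 over `Σ_BA + Σ`, in which every variable is in the scope of precisely one modal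
operator: `Σ_BA`-terms in expressions `♡(t₁, …, tₙ)`, where the `tᵢ` are `Σ_BA`-terms in the
variables. -/
abbrev RankOne (B : BAPresentation.{u}) (S : Sig.{u}) (V : Type u) : Type u :=
  Term B.sig ((o : S.ops) × (Fin (S.ar o) → Term B.sig V))

/-- A rank 1 term as a term over `Σ_BA + Σ`. -/
def RankOne.toTerm {B : BAPresentation.{u}} {S : Sig.{u}} {V W : Type u}
    (σ : V → Term (B.sig.sum S) W) (t : RankOne B S V) : Term (B.sig.sum S) W :=
  Term.inl (fun m => .op (S := B.sig.sum S) (Sum.inr m.1) fun i => Term.inl σ (m.2 i)) t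

/-- An `n`-ary predicate lifting for `T`: a natural transformation `(2ⁿ)^X → 2^{TX}`. -/
structure PredicateLifting (T : Type u ⥤ Type u) (n : ℕ) where
  app (X : Type u) : (Fin n → Set X) → Set (T.obj X)
  natural {X Y : Type u} (f : X ⟶ Y) (a : Fin n → Set Y) :
    app X (fun i => f ⁻¹' a i) = T.map f ⁻¹' app Y a

/-- The semantics `⟦t⟧_h ⊆ TX` of a rank 1 term under a valuation `h : V → 2^X`. -/
def RankOne.sem {B : BAPresentation.{u}} {T : Type u ⥤ Type u} {S : Sig.{u}}
    (Δ : ∀ o : S.ops, PredicateLifting T (S.ar o)) {V X : Type u} (h : V → Set X)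
    (t : RankOne B S V) : Set (T.obj X) :=
  t.eval (B.str (Set (T.obj X))) fun m => (Δ m.1).app X fun i => (m.2 i).eval (B.str (Set X)) h

/-- A concrete logic `(Σ, E, Δ)` for `T`-coalgebras: modal operators, equations of rank 1, and
predicate liftings for which the equations are sound. -/
structure ConcreteLogic (B : BAPresentation.{u}) (T : Type u ⥤ Type u) where
  modal : Sig.{u}
  Var : Type u
  eqs : Set (RankOne B modal Var × RankOne B modal Var)
  Δ : ∀ o : modal.ops, PredicateLifting T (modal.ar o)
  sound : ∀ e ∈ eqs, ∀ (X : Type u) (h : Var → Set X), e.1.sem Δ h = e.2.sem Δ h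

namespace ConcreteLogic

variable {B : BAPresentation.{u}} {T : Type u ⥤ Type u} (𝓒 : ConcreteLogic B T)

/-- The theory `(Σ_BA + Σ, E_BA + E)`. -/
def theory : Theory.{u} where
  sig := B.sig.sum 𝓒.modal
  Var := B.Var ⊕ 𝓒.Var
  eqs := {e | (∃ b ∈ B.eqs, e = (b.1.inl (.var ∘ Sum.inl), b.2.inl (.var ∘ Sum.inl))) ∨
    ∃ m ∈ 𝓒.eqs, e = (m.1.toTerm (.var ∘ Sum.inr), m.2.toTerm (.var ∘ Sum.inr))}

/-- Formulas: terms over `Σ_BA + Σ` with propositional variables in `V`. -/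
abbrev Formula (V : Type u) : Type u := Term 𝓒.theory.sig V

/-- The operations on `2^X` given by a coalgebra `(X, ξ)`: Boolean operations are interpreted
set-theoretically, and modal operators as `ξ⁻¹ ∘ ⟦♡⟧`. -/
def complexStr (X : Endofunctor.Coalgebra T) : Str 𝓒.theory.sig (Set X.V) :=
  fun o => match o with
    | Sum.inl b => B.str (Set X.V) b
    | Sum.inr m => fun a => X.str ⁻¹' (𝓒.Δ m).app X.V a

/-- The concrete semantics of formulas in a coalgebra with valuation `h`, by recursion. -/
def sem (X : Endofunctor.Coalgebra T) {V : Type u} (h : V → Set X.V) (φ : 𝓒.Formula V) :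
    Set X.V :=
  φ.eval (𝓒.complexStr X) h

end ConcreteLogic

/-! ### Agreement of the two semantics -/

section Agreement

variable {B : BAPresentation.{u}} {T : Type u ⥤ Type u} {𝓐 : AbstractLogic T}
  {𝓒 : ConcreteLogic B T} (g : ConcreteIso 𝓐.forget (Alg.forget 𝓒.theory))
  {Fa : Type u ⥤ Endofunctor.Algebra 𝓐.L} (adj : Fa ⊣ 𝓐.forget)
  (f : ∀ V : Type u, 𝓒.theory.free V ≅ g.functor.obj (Fa.obj V))

/-- The element of `Uᵃ Fᵃ V` that corresponds to the class of the formula `φ` under the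
isomorphism `f : Fᶜ V ≅ g(Fᵃ V)`. -/
def interp {V : Type u} (φ : 𝓒.Formula V) : 𝓐.forget.obj (Fa.obj V) :=
  g.carrier (Fa.obj V) ((f V).hom.toFun (𝓒.theory.cls φ))

/-- The isomorphisms `f : Fᶜ V ≅ g(Fᵃ V)` are those induced by `g`, i.e. compatible with the
inclusion of the variables. -/
def Induced : Prop :=
  ∀ (V : Type u) (v : V), interp g f (.var v : 𝓒.Formula V) = adj.unit.app V v

/-- Abstract and concrete semantics agree on all formulas in all coalgebras under all
valuations. -/
def Agree : Prop :=
  ∀ (V : Type u) (X : Endofunctor.Coalgebra T) (h : V → Set X.V) (φ : 𝓒.Formula V),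
    𝓐.sem adj X h (interp g f φ) = 𝓒.sem X h φ

end Agreement

/-- The abstract logic `(L, δ)` and the concrete logic `(Σ, E, Δ)` are equivalent: there is a
concrete isomorphism `g : Alg(L) → Alg(Σ_BA + Σ, E_BA + E)` such that
* for every left adjoint `Fᵃ` of `Uᵃ : Alg(L) → Set`, the isomorphisms `f : Fᶜ V ≅ g(Fᵃ V)` induced
  by `g` exist, and along them both semantics agree;
* a left adjoint `Fᵃ` of `Uᵃ` exists, and it can be chosen such that `g(Fᵃ V) = Fᶜ V`, with both
  semantics agreeing along this identification. -/
def Equivalent {B : BAPresentation.{u}} {T : Type u ⥤ Type u} (𝓐 : AbstractLogic T)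
    (𝓒 : ConcreteLogic B T) : Prop :=
  ∃ g : ConcreteIso 𝓐.forget (Alg.forget 𝓒.theory),
    (∀ (Fa : Type u ⥤ Endofunctor.Algebra 𝓐.L) (adj : Fa ⊣ 𝓐.forget),
      ∃ f : ∀ V : Type u, 𝓒.theory.free V ≅ g.functor.obj (Fa.obj V),
        Induced g adj f ∧ Agree g adj f) ∧
    ∃ (Fa : Type u ⥤ Endofunctor.Algebra 𝓐.L) (adj : Fa ⊣ 𝓐.forget)
      (hF : ∀ V : Type u, 𝓒.theory.free V = g.functor.obj (Fa.obj V)),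
        Induced g adj (fun V => eqToIso (hF V)) ∧ Agree g adj (fun V => eqToIso (hF V))

end CoalgLogic

namespace CoalgLogic

open CategoryTheory Limits Opposite

/-! ### Evaluation of terms -/

/-! Both directions reduce to one notion, `Presentation`: each `L A` is the Boolean algebra
generated by symbols `♡(a₁, …, aₙ)` subject to the instances of the rank 1 equations, naturally in
`A`, and `δ` sends these generators to the predicate liftings. A structure map `L A → A` is then the
same as a family of operations on `A` satisfying the equations. Hence `Presentation.toAlg` is fully
faithful and bijective on objects over `Set`, and the free term algebras, pulled back along it, give
a left adjoint. Both semantics, read on the free algebra, are homomorphisms into the same complex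
algebra with the same values on variables, so they agree (`Presentation.equivalent`).

From abstract to concrete, the `n`-ary operators are the elements of `L (F n)`, with `F n` the free
Boolean algebra on `n` generators. The equations say that these operators respect the Boolean
operations and the action of `L` on maps between free algebras. A Boolean algebra `A` is the colimit
of the free ones over it (`Tuple.isColimit`), indexed by its finite tuples. That index category is
nonempty and has binary coproducts, so it is sifted; `L` preserves this colimit, and the colimit
property of `L A` is exactly the presentation.

From concrete to abstract, `L A` is defined by generators and relations. Operators have finite arity
and equations mention finitely many variables, so everything is decided at one stage of a sifted
diagram. Sifted colimits of Boolean algebras are computed on underlying sets because they commute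
with finite powers (`eq_of_colimitType_eq`, `exists_stage`). This gives `preservesSiftedColimits`.
-/

theorem Term.eval_subst {S : Sig.{u}} {A V W : Type u} (s : Str S A) (h : W → A)
    (σ : V → Term S W) (t : Term S V) :
    (t.subst σ).eval s h = t.eval s fun v => (σ v).eval s h := by
  induction t with
  | var v => rfl
  | op o ts ih => exact congrArg (s o) (funext ih)

theorem Term.eval_inl {S S' : Sig.{u}} {A V W : Type u} (s : Str (S.sum S') A) (h : W → A)
    (σ : V → Term (S.sum S') W) (t : Term S V) :
    (t.inl σ).eval s h =
      t.eval (fun o => s (Sum.inl o)) fun v => (σ v).eval s h := by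
  induction t with
  | var v => rfl
  | op o ts ih => exact congrArg (s (Sum.inl o)) (funext ih)

theorem IsHom.map_eval {S : Sig.{u}} {A A' V : Type u} {s : Str S A} {s' : Str S A'}
    {f : A → A'} (hf : IsHom s s' f) (h : V → A) (t : Term S V) :
    f (t.eval s h) = t.eval s' (f ∘ h) := by
  induction t with
  | var v => rfl
  | op o ts ih => exact (hf o _).trans (congrArg (s' o) (funext ih))

/-- The variables occurring in a term, as a list. -/
def Term.vars {S : Sig.{u}} {V : Type u} : Term S V → List V
  | .var v => [v]
  | .op _ ts => (List.ofFn fun i => (ts i).vars).flatten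

/-- The variable set of a theory may be infinite. Only the finitely many variables of a term matter,
which is what lets an equation be checked at a single stage of a sifted diagram. -/
theorem Term.eval_congr {S : Sig.{u}} {A V : Type u} (s : Str S A) {h h' : V → A}
    (t : Term S V) (hh : ∀ v ∈ t.vars, h v = h' v) : t.eval s h = t.eval s h' := by
  induction t with
  | var v => exact hh v (by simp [Term.vars])
  | op o ts ih =>
    refine congrArg (s o) (funext fun i => ih i fun v hv => hh v ?_)
    simp only [Term.vars, List.mem_flatten, List.mem_ofFn]
    exact ⟨_, ⟨i, rfl⟩, hv⟩

/-! ### Free algebras -/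

theorem Theory.Derives.eval_eq {E : Theory.{u}} {V A : Type u} {s : Str E.sig A} (hs : E.Sat s)
    (h : V → A) {t t' : Term E.sig V} (d : E.Derives V t t') : t.eval s h = t'.eval s h := by
  induction d with
  | ax e he σ => rw [Term.eval_subst, Term.eval_subst]; exact hs e he _
  | refl => rfl
  | symm _ ih => exact ih.symm
  | trans _ _ ih ih' => exact ih.trans ih'
  | congr o a b _ ih => exact congrArg (s o) (funext ih)

theorem Theory.cls_surjective (E : Theory.{u}) {V : Type u} (x : (E.free V).carrier) :
    ∃ t, E.cls t = x :=
  Quotient.exists_rep x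

theorem Theory.free_str_cls (E : Theory.{u}) {V : Type u} (o : E.sig.ops)
    (ts : Fin (E.sig.ar o) → Term E.sig V) :
    (E.free V).str o (fun i => E.cls (ts i)) = E.cls (.op o ts) :=
  E.freeStr_mk V o ts

/-- The homomorphic extension of a valuation to the free algebra. -/
def Theory.freeLift (E : Theory.{u}) {V : Type u} (A : Alg E) (h : V → A.carrier) :
    E.free V ⟶ A where
  toFun := Quotient.lift (s := E.termSetoid V) (fun t => t.eval A.str h)
    fun _ _ d => Theory.Derives.eval_eq A.sat h d
  isHom o a := by
    obtain ⟨ts, rfl⟩ : ∃ ts : _ → Term E.sig V, a = fun i => E.cls (ts i) :=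
      ⟨fun i => (E.cls_surjective (a i)).choose,
        funext fun i => (E.cls_surjective (a i)).choose_spec.symm⟩
    rw [E.free_str_cls]
    rfl

theorem Theory.cls_eq_eval (E : Theory.{u}) {V : Type u} (t : Term E.sig V) :
    E.cls t = t.eval (E.free V).str fun v => E.cls (.var v) := by
  induction t with
  | var v => rfl
  | op o ts ih => rw [← E.free_str_cls]; exact congrArg _ (funext ih)

theorem IsHom.apply_cls {E : Theory.{u}} {V A : Type u} {s : Str E.sig A}
    {f : (E.free V).carrier → A} (hf : IsHom (E.free V).str s f) (t : Term E.sig V) :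
    f (E.cls t) = t.eval s fun v => f (E.cls (.var v)) := by
  rw [E.cls_eq_eval, hf.map_eval]; rfl

theorem IsHom.free_ext {E : Theory.{u}} {V A : Type u} {s : Str E.sig A}
    {f g : (E.free V).carrier → A} (hf : IsHom (E.free V).str s f)
    (hg : IsHom (E.free V).str s g) (h : ∀ v, f (E.cls (.var v)) = g (E.cls (.var v))) :
    f = g := by
  funext x
  obtain ⟨t, rfl⟩ := E.cls_surjective x
  rw [hf.apply_cls, hg.apply_cls, funext h]

/-- Maps from a set into an algebra are homomorphisms from the free algebra. -/
def Theory.freeHomEquiv (E : Theory.{u}) (V : Type u) (A : Alg E) :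
    (E.free V ⟶ A) ≃ (V → A.carrier) where
  toFun f v := f.toFun (E.cls (.var v))
  invFun := E.freeLift A
  left_inv f := Alg.Hom.ext ((E.freeLift A _).isHom.free_ext f.isHom fun _ => rfl)
  right_inv _ := rfl

/-! ### Algebras presented by generators and relations -/

/-- Two terms in the generators `G` are identified if they have the same value in every algebra
under every valuation of the generators that satisfies the relations. -/
def Theory.presSetoid (E : Theory.{u}) {G : Type u} (R : Term E.sig G → Term E.sig G → Prop) :
    Setoid (Term E.sig G) where
  r t t' := ∀ (A : Alg E) (h : G → A.carrier),
    (∀ r r', R r r' → r.eval A.str h = r'.eval A.str h) → t.eval A.str h = t'.eval A.str h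
  iseqv := ⟨fun _ _ _ _ => rfl, fun H A h hR => (H A h hR).symm,
    fun H H' A h hR => (H A h hR).trans (H' A h hR)⟩

/-- The class of a term in the presented algebra. -/
def Theory.presMk (E : Theory.{u}) {G : Type u} (R : Term E.sig G → Term E.sig G → Prop)
    (t : Term E.sig G) : Quotient (E.presSetoid R) :=
  Quotient.mk _ t

/-- The operations on classes of terms. -/
noncomputable def Theory.presStr (E : Theory.{u}) {G : Type u}
    (R : Term E.sig G → Term E.sig G → Prop) : Str E.sig (Quotient (E.presSetoid R)) :=
  fun o a => E.presMk R (.op o fun i => (a i).out)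

theorem Theory.presStr_presMk (E : Theory.{u}) {G : Type u}
    (R : Term E.sig G → Term E.sig G → Prop) (o : E.sig.ops)
    (ts : Fin (E.sig.ar o) → Term E.sig G) :
    E.presStr R o (fun i => E.presMk R (ts i)) = E.presMk R (.op o ts) :=
  Quotient.sound (s := E.presSetoid R) fun A h hR => congrArg (A.str o) <| funext fun i =>
    Quotient.exact (s := E.presSetoid R) (Quotient.out_eq (E.presMk R (ts i))) A h hR

theorem Theory.eval_presStr (E : Theory.{u}) {G W : Type u}
    (R : Term E.sig G → Term E.sig G → Prop) (σ : W → Term E.sig G) (t : Term E.sig W) :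
    t.eval (E.presStr R) (fun w => E.presMk R (σ w)) = E.presMk R (t.subst σ) := by
  induction t with
  | var v => rfl
  | op o ts ih =>
    simp only [Term.eval, ih, E.presStr_presMk]
    rfl

/-- The algebra presented by generators `G` and relations `R`. -/
noncomputable def Theory.pres (E : Theory.{u}) {G : Type u}
    (R : Term E.sig G → Term E.sig G → Prop) : Alg E where
  carrier := Quotient (E.presSetoid R)
  str := E.presStr R
  sat e he h := by
    obtain ⟨σ, rfl⟩ : ∃ σ : _ → Term E.sig G, h = fun w => E.presMk R (σ w) :=
      ⟨fun w => (h w).out, funext fun w => (Quotient.out_eq (h w)).symm⟩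
    rw [E.eval_presStr, E.eval_presStr]
    refine Quotient.sound (s := E.presSetoid R) fun A h _ => ?_
    rw [Term.eval_subst, Term.eval_subst]
    exact A.sat e he _

/-- The generators of the presented algebra. -/
def Theory.presGen (E : Theory.{u}) {G : Type u} (R : Term E.sig G → Term E.sig G → Prop)
    (g : G) : (E.pres R).carrier :=
  E.presMk R (.var g)

theorem Theory.pres_eval (E : Theory.{u}) {G : Type u} (R : Term E.sig G → Term E.sig G → Prop)
    (t : Term E.sig G) :
    t.eval (E.pres R).str (E.presGen R) = E.presMk R t := by
  refine (E.eval_presStr R .var t).trans (congrArg _ ?_)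
  induction t with
  | var v => rfl
  | op o ts ih => exact congrArg (Term.op o) (funext ih)

/-- `presSetoid` tests equality against all algebras satisfying the relations, so a relation holds
in the quotient simply because every test algebra is assumed to satisfy it. -/
theorem Theory.pres_rel (E : Theory.{u}) {G : Type u} (R : Term E.sig G → Term E.sig G → Prop)
    {r r' : Term E.sig G} (h : R r r') :
    r.eval (E.pres R).str (E.presGen R) =
      r'.eval (E.pres R).str (E.presGen R) := by
  rw [E.pres_eval, E.pres_eval]
  exact Quotient.sound (s := E.presSetoid R) fun A h' hR => hR _ _ h

/-- The universal property of the presented algebra. -/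
def Theory.presLift (E : Theory.{u}) {G : Type u} (R : Term E.sig G → Term E.sig G → Prop)
    (A : Alg E) (h : G → A.carrier) (hR : ∀ r r', R r r' → r.eval A.str h = r'.eval A.str h) :
    E.pres R ⟶ A where
  toFun := Quotient.lift (s := E.presSetoid R) (fun t => t.eval A.str h) fun _ _ H => H A h hR
  isHom o a := by
    obtain ⟨ts, rfl⟩ : ∃ ts : _ → Term E.sig G, a = fun i => E.presMk R (ts i) :=
      ⟨fun i => (a i).out, funext fun i => (Quotient.out_eq (a i)).symm⟩
    refine (congrArg _ (E.presStr_presMk R o ts)).trans ?_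
    rfl

theorem IsHom.pres_ext {E : Theory.{u}} {G A : Type u} {R : Term E.sig G → Term E.sig G → Prop}
    {s : Str E.sig A} {f g : (E.pres R).carrier → A} (hf : IsHom (E.pres R).str s f)
    (hg : IsHom (E.pres R).str s g)
    (h : ∀ v, f (E.presGen R v) = g (E.presGen R v)) : f = g := by
  funext x
  obtain ⟨t, rfl⟩ : ∃ t, E.presMk R t = x := Quotient.exists_rep x
  have H : f ∘ E.presGen R = g ∘ E.presGen R := funext h
  have H' := hf.map_eval (E.presGen R) t
  rw [H, ← hg.map_eval, E.pres_eval] at H'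
  exact H'

/-! ### Boolean algebras as algebras for the presentation -/

namespace BAPresentation

variable (B : BAPresentation.{u})

theorem sat_str (A : Type u) [a : BooleanAlgebra A] : B.toTheory.Sat (B.str A) :=
  (B.equiv A a).2

/-- A Boolean algebra as an algebra for the presentation. -/
def toAlg (A : BoolAlg.{u}) : Alg B.toTheory :=
  ⟨A, B.str A, B.sat_str A⟩

/-- An algebra for the presentation as a Boolean algebra. -/
def ofStr {A : Type u} (s : Str B.sig A) (hs : B.toTheory.Sat s) : BoolAlg.{u} :=
  @BoolAlg.of A ((B.equiv A).symm ⟨s, hs⟩)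

/-- The two structures agree only through the bijection `B.equiv`, not by unfolding, so this rewrite
precedes every transfer of homomorphisms to or from `ofStr`. -/
theorem str_ofStr {A : Type u} (s : Str B.sig A) (hs : B.toTheory.Sat s) :
    B.str (B.ofStr s hs) = s :=
  congrArg Subtype.val ((B.equiv A).apply_symm_apply ⟨s, hs⟩)

theorem isHom {X Y : BoolAlg.{u}} (f : X ⟶ Y) : IsHom (B.str X) (B.str Y) f :=
  (B.hom_iff X Y X.str Y.str f).1 ⟨f.hom, rfl⟩

/-- Homomorphisms for the presentation as homomorphisms of Boolean algebras. -/
noncomputable def homOf {X Y : BoolAlg.{u}} (f : X → Y) (hf : IsHom (B.str X) (B.str Y) f) :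
    X ⟶ Y :=
  BoolAlg.ofHom ((B.hom_iff X Y X.str Y.str f).2 hf).choose

@[simp]
theorem homOf_apply {X Y : BoolAlg.{u}} (f : X → Y) (hf : IsHom (B.str X) (B.str Y) f) (x : X) :
    B.homOf f hf x = f x :=
  congrFun ((B.hom_iff X Y X.str Y.str f).2 hf).choose_spec x

end BAPresentation

/-- The value of a rank 1 term, where the variables take values in `A` and the modal operators map
`A` to `C`. -/
def RankOne.value {B : BAPresentation.{u}} {S : Sig.{u}} {V : Type u} {A C : BoolAlg.{u}}
    (m : ∀ o : S.ops, (Fin (S.ar o) → A) → C) (h : V → A) (t : RankOne B S V) : C :=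
  t.eval (B.str C) fun q => m q.1 fun i => (q.2 i).eval (B.str A) h

theorem RankOne.map_value {B : BAPresentation.{u}} {S : Sig.{u}} {V : Type u}
    {A C C' : BoolAlg.{u}} (m : ∀ o : S.ops, (Fin (S.ar o) → A) → C) (h : V → A)
    (f : C ⟶ C') (t : RankOne B S V) :
    f (t.value m h) = t.value (fun o a => f (m o a)) h :=
  (B.isHom f).map_eval _ _

theorem RankOne.value_comp {B : BAPresentation.{u}} {S : Sig.{u}} {V : Type u}
    {A A' C : BoolAlg.{u}} (m : ∀ o : S.ops, (Fin (S.ar o) → A') → C) (h : V → A)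
    (f : A ⟶ A') (t : RankOne B S V) :
    t.value m (f ∘ h) = t.value (fun o a => m o (f ∘ a)) h := by
  unfold RankOne.value
  congr 1
  funext q
  congr 1
  funext i
  exact ((B.isHom f).map_eval h (q.2 i)).symm

theorem RankOne.eval_toTerm {B : BAPresentation.{u}} {S : Sig.{u}} {V W X : Type u}
    (s : Str (B.sig.sum S) X) (h : W → X) (σ : V → Term (B.sig.sum S) W) (t : RankOne B S V) :
    (t.toTerm σ).eval s h = t.eval (fun o => s (Sum.inl o)) fun q => s (Sum.inr q.1) fun i =>
      (q.2 i).eval (fun o => s (Sum.inl o)) fun v => (σ v).eval s h := by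
  unfold RankOne.toTerm
  rw [Term.eval_inl]
  congr 1
  funext q
  exact congrArg (s (Sum.inr q.1)) (funext fun i => Term.eval_inl _ _ _ _)

/-! ### Concrete isomorphisms from functors that are bijective on objects -/

/-- The strict inverse of a fully faithful functor that is bijective on objects. -/
noncomputable def strictInverse {C D : Type (u + 1)} [Category.{u} C] [Category.{u} D]
    (G : C ⥤ D) [G.Full] [G.Faithful] (i : D → C) (hi : ∀ d, G.obj (i d) = d) : D ⥤ C where
  obj := i
  map {d d'} f := G.preimage (eqToHom (hi d) ≫ f ≫ eqToHom (hi d').symm)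
  map_id d := G.map_injective (by simp)
  map_comp f f' := G.map_injective (by simp)

theorem comp_strictInverse {C D : Type (u + 1)} [Category.{u} C] [Category.{u} D]
    (G : C ⥤ D) [G.Full] [G.Faithful] (i : D → C) (hi : ∀ d, G.obj (i d) = d)
    (hi' : ∀ c, i (G.obj c) = c) : G ⋙ strictInverse G i hi = 𝟭 C :=
  CategoryTheory.Functor.ext hi' fun c c' f => G.map_injective <| by
    have h : G.map (eqToHom (hi' c) ≫ f ≫ eqToHom (hi' c').symm) =
        eqToHom (hi (G.obj c)) ≫ G.map f ≫ eqToHom (hi (G.obj c')).symm := by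
      simp [eqToHom_map]
    exact (G.map_preimage _).trans h.symm

theorem strictInverse_comp {C D : Type (u + 1)} [Category.{u} C] [Category.{u} D]
    (G : C ⥤ D) [G.Full] [G.Faithful] (i : D → C) (hi : ∀ d, G.obj (i d) = d) :
    strictInverse G i hi ⋙ G = 𝟭 D :=
  CategoryTheory.Functor.ext hi fun _ _ _ => G.map_preimage _

/-- A functor over `Set` that is fully faithful and bijective on objects is a concrete
isomorphism. -/
noncomputable def ConcreteIso.ofBijective {C D : Type (u + 1)} [Category.{u} C] [Category.{u} D]
    {U : C ⥤ Type u} {U' : D ⥤ Type u} (G : C ⥤ D) [G.Full] [G.Faithful]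
    (hG : Function.Bijective G.obj) (hU : G ⋙ U' = U) : ConcreteIso U U' where
  functor := G
  inverse := strictInverse G (Function.surjInv hG.2) (Function.surjInv_eq hG.2)
  functor_inverse := comp_strictInverse G _ _ (Function.leftInverse_surjInv hG)
  inverse_functor := strictInverse_comp G _ _
  functor_forget := hU

/-! ### Functors presented by operations and equations -/

/-- The functor `L` of an abstract logic is presented by the modal operators and the equations of a
concrete logic, in such a way that `δ` is given by the predicate liftings. -/
structure Presentation {B : BAPresentation.{u}} {T : Type u ⥤ Type u} (𝓐 : AbstractLogic T)
    (𝓒 : ConcreteLogic B T) where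
  /-- the generators `♡(a₁, …, aₙ)` of `L A` -/
  gen (A : BoolAlg.{u}) (o : 𝓒.modal.ops) (a : Fin (𝓒.modal.ar o) → A) : 𝓐.L.obj A
  map_gen {A A' : BoolAlg.{u}} (f : A ⟶ A') (o : 𝓒.modal.ops) (a : Fin (𝓒.modal.ar o) → A) :
    𝓐.L.map f (gen A o a) = gen A' o (f ∘ a)
  gen_eqs : ∀ e ∈ 𝓒.eqs, ∀ (A : BoolAlg.{u}) (h : 𝓒.Var → A),
    e.1.value (gen A) h = e.2.value (gen A) h
  exists_lift (A C : BoolAlg.{u}) (m : ∀ o : 𝓒.modal.ops, (Fin (𝓒.modal.ar o) → A) → C)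
    (hm : ∀ e ∈ 𝓒.eqs, ∀ h : 𝓒.Var → A, e.1.value m h = e.2.value m h) :
    ∃ φ : 𝓐.L.obj A ⟶ C, ∀ o a, φ (gen A o a) = m o a
  hom_ext {A C : BoolAlg.{u}} {φ ψ : 𝓐.L.obj A ⟶ C}
    (h : ∀ o a, φ (gen A o a) = ψ (gen A o a)) : φ = ψ
  δ_gen (X : Type u) (o : 𝓒.modal.ops) (a : Fin (𝓒.modal.ar o) → Set X) :
    𝓐.δ.app (op X) (gen (powerset.obj (op X)) o a) = (𝓒.Δ o).app X a

namespace Presentation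

variable {B : BAPresentation.{u}} {T : Type u ⥤ Type u} {𝓐 : AbstractLogic T}
  {𝓒 : ConcreteLogic B T} (p : Presentation 𝓐 𝓒)

/-- The operations on the carrier of an `L`-algebra. -/
def algStr (A : Endofunctor.Algebra 𝓐.L) : Str 𝓒.theory.sig A.a :=
  fun o => match o with
    | Sum.inl b => B.str A.a b
    | Sum.inr m => fun a => A.str (p.gen A.a m a)

theorem sat_theory_iff {X : Type u} (s : Str (B.sig.sum 𝓒.modal) X) :
    𝓒.theory.Sat s ↔ (∀ b ∈ B.eqs, ∀ h : B.Var → X,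
        b.1.eval (fun o => s (Sum.inl o)) h = b.2.eval (fun o => s (Sum.inl o)) h) ∧
      ∀ m ∈ 𝓒.eqs, ∀ h : 𝓒.Var → X,
        m.1.eval (fun o => s (Sum.inl o)) (fun q => s (Sum.inr q.1) fun i =>
            (q.2 i).eval (fun o => s (Sum.inl o)) h) =
          m.2.eval (fun o => s (Sum.inl o)) (fun q => s (Sum.inr q.1) fun i =>
            (q.2 i).eval (fun o => s (Sum.inl o)) h) := by
  constructor
  · intro hs
    -- The variables of the theory form the sum `B.Var ⊕ 𝓒.Var`, so a valuation of one summand needs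
    -- a default value on the other. On an empty carrier all equations hold trivially.
    by_cases hX : Nonempty X
    · obtain ⟨x⟩ := hX
      constructor
      · intro b hb h
        have := hs _ (Or.inl ⟨b, hb, rfl⟩) (Sum.elim h fun _ => x)
        exact (Term.eval_inl s _ _ b.1).symm.trans (this.trans (Term.eval_inl s _ _ b.2))
      · intro m hm h
        have := hs _ (Or.inr ⟨m, hm, rfl⟩) (Sum.elim (fun _ => x) h)
        exact (m.1.eval_toTerm s _ _).symm.trans (this.trans (m.2.eval_toTerm s _ _))
    · rw [not_nonempty_iff] at hX
      exact ⟨fun _ _ _ => Subsingleton.elim _ _, fun _ _ _ => Subsingleton.elim _ _⟩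
  · rintro ⟨h₁, h₂⟩ e (⟨b, hb, rfl⟩ | ⟨m, hm, rfl⟩) h
    · exact (Term.eval_inl s _ _ b.1).trans ((h₁ b hb _).trans (Term.eval_inl s _ _ b.2).symm)
    · exact (m.1.eval_toTerm s _ _).trans ((h₂ m hm _).trans (m.2.eval_toTerm s _ _).symm)

/-- The equations hold between generators of `L A`, and the structure map, being a Boolean
homomorphism, carries them to `A`. -/
theorem sat_algStr (A : Endofunctor.Algebra 𝓐.L) : 𝓒.theory.Sat (p.algStr A) := by
  refine (sat_theory_iff _).2 ⟨B.sat_str A.a, fun m hm h => ?_⟩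
  have := congrArg A.str (p.gen_eqs m hm A.a h)
  rwa [RankOne.map_value, RankOne.map_value] at this

theorem map_str_gen {A A' : Endofunctor.Algebra 𝓐.L} (f : A ⟶ A') (m : 𝓒.modal.ops)
    (a : Fin (𝓒.modal.ar m) → A.a) :
    A'.str (p.gen A'.a m (f.f ∘ a)) = f.f (A.str (p.gen A.a m a)) := by
  rw [← p.map_gen, ← BoolAlg.comp_apply, f.h, BoolAlg.comp_apply]

/-- The functor from `L`-algebras to algebras for the signature and the equations. -/
def toAlg : Endofunctor.Algebra 𝓐.L ⥤ Alg 𝓒.theory where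
  obj A := ⟨A.a, p.algStr A, p.sat_algStr A⟩
  map {A A'} f := ⟨f.f, fun o => match o with
    | Sum.inl b => B.isHom f.f b
    | Sum.inr m => fun a => (p.map_str_gen f m a).symm⟩

instance : p.toAlg.Faithful where
  map_injective h :=
    Endofunctor.Algebra.Hom.ext (BoolAlg.ext fun x => congrFun (congrArg Alg.Hom.toFun h) x)

instance : p.toAlg.Full where
  map_surjective {A A'} f := by
    have hB : IsHom (B.str A.a) (B.str A'.a) f.toFun := fun o => f.isHom (Sum.inl o)
    obtain ⟨k, hk⟩ : ∃ k : A.a ⟶ A'.a, ⇑k = f.toFun := ⟨B.homOf _ hB, funext (B.homOf_apply _ hB)⟩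
    -- The square of an `L`-algebra morphism commutes once it does so on generators, and there it
    -- says that `f` preserves the modal operators.
    refine ⟨⟨k, p.hom_ext fun o a => ?_⟩, Alg.Hom.ext hk⟩
    rw [BoolAlg.comp_apply, BoolAlg.comp_apply, p.map_gen, hk]
    exact (f.isHom (Sum.inr o) a).symm

/-- On a fixed set, the Boolean part of the operations determines the Boolean algebra by `B.equiv`,
and the modal part determines the structure map on generators. -/
theorem toAlg_obj_injective : Function.Injective p.toAlg.obj := by
  rintro ⟨@⟨X, a⟩, α⟩ ⟨@⟨X', a'⟩, α'⟩ h
  obtain ⟨hX, hs⟩ := (Alg.mk.injEq ..).mp h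
  obtain rfl : X = X' := hX
  have hs' := eq_of_heq hs
  have ha : (B.equiv X a) = B.equiv X a' :=
    Subtype.ext (funext fun o => congrFun hs' (Sum.inl o))
  obtain rfl := (B.equiv X).injective ha
  obtain rfl : α = α' := p.hom_ext fun o b => congrFun (congrFun hs' (Sum.inr o)) b
  rfl

theorem toAlg_obj_surjective : Function.Surjective p.toAlg.obj := by
  rintro ⟨X, s, hs⟩
  obtain ⟨h₁, h₂⟩ := (sat_theory_iff _).1 hs
  obtain ⟨a, ha⟩ := (B.equiv X).surjective ⟨fun o => s (Sum.inl o), h₁⟩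
  have ha' : B.str X = fun o => s (Sum.inl o) := congrArg Subtype.val ha
  -- The modal equations of the given algebra are exactly the compatibility that `exists_lift` asks
  -- for, so the modal operators assemble into a structure map.
  obtain ⟨α, hα⟩ := p.exists_lift (BoolAlg.of X) (BoolAlg.of X)
    (fun o b => s (Sum.inr o) b) (by
      intro m hm h
      have := h₂ m hm h
      rwa [← ha'] at this)
  refine ⟨⟨BoolAlg.of X, α⟩, ?_⟩
  have : p.algStr ⟨BoolAlg.of X, α⟩ = s := by
    funext o
    rcases o with o | o
    · exact congrFun ha' o
    · exact funext fun b => hα o b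
  subst this
  rfl

/-- The concrete isomorphism between `Alg(L)` and the category of algebras for the signature and
the equations. -/
noncomputable def iso : ConcreteIso 𝓐.forget (Alg.forget 𝓒.theory) :=
  ConcreteIso.ofBijective p.toAlg ⟨p.toAlg_obj_injective, p.toAlg_obj_surjective⟩ rfl

theorem algStr_tildeP (X : Endofunctor.Coalgebra T) :
    p.algStr (𝓐.tildeP X) = 𝓒.complexStr X := by
  funext o
  rcases o with o | o
  · rfl
  · funext a
    refine (BoolAlg.comp_apply _ _ _).trans ?_
    exact congrArg (fun s => X.str ⁻¹' s) (p.δ_gen X.V o a)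

/-- The abstract semantics composed with `f` is a homomorphism from the free algebra to the complex
algebra of the coalgebra. It is therefore evaluation of terms, determined by its values on
variables, where `Induced` and the adjunction give `h`. -/
theorem agree_of_induced {Fa : Type u ⥤ Endofunctor.Algebra 𝓐.L} (adj : Fa ⊣ 𝓐.forget)
    (f : ∀ V : Type u, 𝓒.theory.free V ≅ p.iso.functor.obj (Fa.obj V))
    (hf : Induced p.iso adj f) : Agree p.iso adj f := by
  intro V X h φ
  let k := (f V).hom ≫ p.toAlg.map ((adj.homEquiv V (𝓐.tildeP X)).symm (TypeCat.ofHom h))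
  have hk := k.isHom.apply_cls φ
  refine hk.trans ?_
  have hs : (p.toAlg.obj (𝓐.tildeP X)).str = 𝓒.complexStr X := p.algStr_tildeP X
  refine (congrArg (fun s => φ.eval s _) hs).trans ?_
  refine congrArg (φ.eval (𝓒.complexStr X)) (funext fun v => ?_)
  have h₁ : k.toFun (𝓒.theory.cls (.var v)) = 𝓐.sem adj X h (interp p.iso f (.var v)) := rfl
  rw [h₁, hf V v]
  have h₂ := (adj.homEquiv V (𝓐.tildeP X)).apply_symm_apply (TypeCat.ofHom h)
  rw [Adjunction.homEquiv_unit] at h₂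
  exact types_congr_hom h₂ v

/-- Homomorphisms from the preimage of the free algebra are maps from the generators. -/
noncomputable def freeHomEquiv {F : Type u → Endofunctor.Algebra 𝓐.L}
    (hF : ∀ V, 𝓒.theory.free V = p.iso.functor.obj (F V)) (V : Type u)
    (A : Endofunctor.Algebra 𝓐.L) : (F V ⟶ A) ≃ (V ⟶ 𝓐.forget.obj A) :=
  (Functor.FullyFaithful.ofFullyFaithful p.toAlg).homEquiv.trans <|
    ((eqToIso (hF V)).homFromEquiv.symm.trans
      (𝓒.theory.freeHomEquiv V (p.toAlg.obj A))).trans TypeCat.homEquiv.symm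

theorem equivalent (p : Presentation 𝓐 𝓒) : Equivalent 𝓐 𝓒 := by
  -- Surjectivity on objects supplies preimages of the term algebras up to equality, as the second
  -- clause of `Equivalent` demands.
  obtain ⟨F, hF⟩ : ∃ F : Type u → Endofunctor.Algebra 𝓐.L,
      ∀ V, 𝓒.theory.free V = p.iso.functor.obj (F V) :=
    ⟨fun V => (p.toAlg_obj_surjective (𝓒.theory.free V)).choose,
      fun V => (p.toAlg_obj_surjective (𝓒.theory.free V)).choose_spec.symm⟩
  let adj := Adjunction.adjunctionOfEquivLeft (G := 𝓐.forget) (p.freeHomEquiv hF)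
    (by
      intros
      exact ConcreteCategory.hom_ext _ _ fun _ => rfl)
  have hi : Induced p.iso adj (fun V => eqToIso (hF V)) := by
    intro V v
    have h : adj.homEquiv V _ (𝟙 _) = adj.unit.app V := adj.homEquiv_id V
    rw [← h]
    rfl
  refine ⟨p.iso, fun Fa adj' => ?_, _, adj, hF, hi, p.agree_of_induced adj _ hi⟩
  -- An arbitrary left adjoint is compared with the constructed one by uniqueness of left adjoints,
  -- which respects units.
  have hf : Induced p.iso adj' fun V => eqToIso (hF V) ≪≫
      p.iso.functor.mapIso ((Adjunction.leftAdjointUniq adj adj').app V) := by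
    intro V v
    have h := types_congr_hom (Adjunction.unit_leftAdjointUniq_hom_app adj adj' V) v
    rw [← h, types_comp_apply, ← hi V v]
    rfl
  exact ⟨_, hf, p.agree_of_induced adj' _ hf⟩

end Presentation

/-! ### Finitely generated free Boolean algebras -/

namespace BAPresentation

variable (B : BAPresentation.{u})

/-- The free Boolean algebra on `n` generators. -/
noncomputable def fin (n : ℕ) : BoolAlg.{u} :=
  B.ofStr (B.toTheory.free (ULift.{u} (Fin n))).str (B.toTheory.free _).sat

/-- The element of the free Boolean algebra given by a term. -/
def finMk {n : ℕ} (t : Term B.sig (ULift.{u} (Fin n))) : B.fin n :=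
  B.toTheory.cls t

/-- The generators of the free Boolean algebra. -/
def finVar {n : ℕ} (i : Fin n) : B.fin n :=
  B.finMk (.var ⟨i⟩)

theorem finMk_surjective {n : ℕ} (x : B.fin n) : ∃ t, B.finMk t = x :=
  B.toTheory.cls_surjective x

theorem str_fin (n : ℕ) : B.str (B.fin n) = (B.toTheory.free (ULift.{u} (Fin n))).str :=
  B.str_ofStr _ _

theorem finMk_eq_eval {n : ℕ} (t : Term B.sig (ULift.{u} (Fin n))) :
    B.finMk t = t.eval (B.str (B.fin n)) fun i => B.finVar i.down := by
  rw [str_fin]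
  exact B.toTheory.cls_eq_eval t

variable {B}

theorem map_finMk {n : ℕ} {A : BoolAlg.{u}} (f : B.fin n ⟶ A)
    (t : Term B.sig (ULift.{u} (Fin n))) :
    f (B.finMk t) = t.eval (B.str A) fun i => f (B.finVar i.down) := by
  rw [finMk_eq_eval, (B.isHom f).map_eval]
  rfl

theorem fin_hom_ext {n : ℕ} {A : BoolAlg.{u}} {f g : B.fin n ⟶ A}
    (h : ∀ i, f (B.finVar i) = g (B.finVar i)) : f = g := by
  refine BoolAlg.ext fun x => ?_
  obtain ⟨t, rfl⟩ := B.finMk_surjective x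
  simp only [map_finMk, h]

variable (B)

theorem exists_finLift {n : ℕ} {A : BoolAlg.{u}} (a : Fin n → A) :
    ∃ f : B.fin n ⟶ A, ∀ i, f (B.finVar i) = a i := by
  let k := B.toTheory.freeLift (B.toAlg A) fun i : ULift.{u} (Fin n) => a i.down
  have hk : IsHom (B.str (B.fin n)) (B.str A) k.toFun := by
    rw [str_fin]
    exact k.isHom
  exact ⟨B.homOf (X := B.fin n) k.toFun hk, fun i => B.homOf_apply (X := B.fin n) k.toFun hk _⟩

/-- The homomorphic extension of a valuation of the generators. -/
noncomputable def finLift {n : ℕ} {A : BoolAlg.{u}} (a : Fin n → A) : B.fin n ⟶ A :=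
  (B.exists_finLift a).choose

@[simp]
theorem finLift_finVar {n : ℕ} {A : BoolAlg.{u}} (a : Fin n → A) (i : Fin n) :
    B.finLift a (B.finVar i) = a i :=
  (B.exists_finLift a).choose_spec i

theorem finLift_finMk {n : ℕ} {A : BoolAlg.{u}} (a : Fin n → A)
    (t : Term B.sig (ULift.{u} (Fin n))) :
    B.finLift a (B.finMk t) = t.eval (B.str A) fun i => a i.down := by
  simp only [map_finMk, finLift_finVar]

theorem finLift_comp {n : ℕ} {A A' : BoolAlg.{u}} (a : Fin n → A) (f : A ⟶ A') :
    B.finLift a ≫ f = B.finLift (f ∘ a) :=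
  fin_hom_ext fun i => by simp

end BAPresentation

/-! ### Boolean algebras as sifted colimits of finitely generated free ones -/

/-- The finite tuples of elements of a Boolean algebra. -/
structure Tuple (B : BAPresentation.{u}) (A : BoolAlg.{u}) : Type u where
  n : ℕ
  val : Fin n → A

namespace Tuple

variable {B : BAPresentation.{u}} {A : BoolAlg.{u}}

/-- A morphism of tuples expresses the elements of the first tuple by those of the second one. -/
@[ext]
structure Hom (x y : Tuple B A) where
  hom : B.fin x.n ⟶ B.fin y.n
  w : hom ≫ B.finLift y.val = B.finLift x.val

noncomputable instance : SmallCategory (Tuple B A) where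
  Hom := Hom
  id x := ⟨𝟙 _, Category.id_comp _⟩
  comp f g := ⟨f.hom ≫ g.hom, by rw [Category.assoc, g.w, f.w]⟩

@[ext]
theorem hom_ext {x y : Tuple B A} {f g : x ⟶ y} (h : f.hom = g.hom) : f = g :=
  Hom.ext h

/-- A morphism of tuples given by the images of the generators. -/
noncomputable def homMk {x y : Tuple B A} (a : Fin x.n → B.fin y.n)
    (ha : ∀ i, B.finLift y.val (a i) = x.val i) : x ⟶ y where
  hom := B.finLift a
  w := BAPresentation.fin_hom_ext fun i => by simp [ha]

theorem homMk_hom_finVar {x y : Tuple B A} (a : Fin x.n → B.fin y.n)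
    (ha : ∀ i, B.finLift y.val (a i) = x.val i) (i : Fin x.n) :
    (homMk a ha).hom (B.finVar i) = a i :=
  B.finLift_finVar a i

theorem comp_hom_apply {x y z : Tuple B A} (f : x ⟶ y) (g : y ⟶ z) (e : B.fin x.n) :
    (f ≫ g).hom e = g.hom (f.hom e) :=
  BoolAlg.comp_apply _ _ _

theorem finLift_hom_apply {x y : Tuple B A} (f : x ⟶ y) (e : B.fin x.n) :
    B.finLift y.val (f.hom e) = B.finLift x.val e := by
  rw [← f.w, BoolAlg.comp_apply]

/-- Nonemptiness and binary coproducts together make the category of tuples sifted. -/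
instance : Nonempty (Tuple B A) := ⟨⟨0, Fin.elim0⟩⟩

/-- Concatenation of tuples. -/
abbrev append (x y : Tuple B A) : Tuple B A := ⟨x.n + y.n, Fin.append x.val y.val⟩

noncomputable def inl (x y : Tuple B A) : x ⟶ x.append y :=
  homMk (fun i => B.finVar (Fin.castAdd y.n i)) fun i =>
    (B.finLift_finVar _ _).trans (Fin.append_left x.val y.val i)

noncomputable def inr (x y : Tuple B A) : y ⟶ x.append y :=
  homMk (fun i => B.finVar (Fin.natAdd x.n i)) fun i =>
    (B.finLift_finVar _ _).trans (Fin.append_right x.val y.val i)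

noncomputable def desc {x y z : Tuple B A} (f : x ⟶ z) (g : y ⟶ z) : x.append y ⟶ z :=
  homMk (Fin.append (fun i => f.hom (B.finVar i)) fun i => g.hom (B.finVar i)) fun i => by
    refine Fin.addCases (fun i => ?_) (fun i => ?_) i
    · rw [Fin.append_left, finLift_hom_apply, B.finLift_finVar]
      exact (Fin.append_left x.val y.val i).symm
    · rw [Fin.append_right, finLift_hom_apply, B.finLift_finVar]
      exact (Fin.append_right x.val y.val i).symm

theorem inl_finVar (x y : Tuple B A) (i : Fin x.n) :
    (inl x y).hom (B.finVar i) = B.finVar (Fin.castAdd y.n i) :=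
  homMk_hom_finVar _ _ _

theorem inr_finVar (x y : Tuple B A) (i : Fin y.n) :
    (inr x y).hom (B.finVar i) = B.finVar (Fin.natAdd x.n i) :=
  homMk_hom_finVar _ _ _

theorem inl_desc {x y z : Tuple B A} (f : x ⟶ z) (g : y ⟶ z) : inl x y ≫ desc f g = f :=
  hom_ext <| BAPresentation.fin_hom_ext fun i => by
    rw [comp_hom_apply, inl_finVar]
    exact (homMk_hom_finVar _ _ _).trans (Fin.append_left _ _ _)

theorem inr_desc {x y z : Tuple B A} (f : x ⟶ z) (g : y ⟶ z) : inr x y ≫ desc f g = g :=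
  hom_ext <| BAPresentation.fin_hom_ext fun i => by
    rw [comp_hom_apply, inr_finVar]
    exact (homMk_hom_finVar _ _ _).trans (Fin.append_right _ _ _)

theorem append_hom_ext {x y z : Tuple B A} {f g : x.append y ⟶ z}
    (hl : inl x y ≫ f = inl x y ≫ g) (hr : inr x y ≫ f = inr x y ≫ g) : f = g :=
  hom_ext <| BAPresentation.fin_hom_ext fun i => by
    refine Fin.addCases (fun i => ?_) (fun i => ?_) i
    · have := congrArg (fun k => Hom.hom k (B.finVar i)) hl
      rwa [comp_hom_apply, comp_hom_apply, inl_finVar] at this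
    · have := congrArg (fun k => Hom.hom k (B.finVar i)) hr
      rwa [comp_hom_apply, comp_hom_apply, inr_finVar] at this

/-- Concatenation is a coproduct because the free algebra on `m + n` generators is free on the two
blocks of generators. -/
instance : HasBinaryCoproducts (Tuple B A) :=
  have (x y : Tuple B A) : HasColimit (pair x y) := ⟨⟨⟨BinaryCofan.mk (inl x y) (inr x y),
    BinaryCofan.IsColimit.mk _ desc inl_desc inr_desc fun f g _ hl hr =>
      append_hom_ext (hl.trans (inl_desc f g).symm) (hr.trans (inr_desc f g).symm)⟩⟩⟩
  hasBinaryCoproducts_of_hasColimit_pair _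

variable (B A)

/-- The diagram of finitely generated free Boolean algebras over a Boolean algebra. -/
noncomputable def diagram : Tuple B A ⥤ BoolAlg.{u} where
  obj x := B.fin x.n
  map f := f.hom

/-- The cocone of a Boolean algebra over the finitely generated free ones. -/
noncomputable def cocone : Cocone (diagram B A) where
  pt := A
  ι :=
    { app x := B.finLift x.val
      naturality _ _ f := f.w.trans (Category.comp_id _).symm }

variable {B A}

/-- The tuple consisting of one element. -/
abbrev single (a : A) : Tuple B A := ⟨1, fun _ => a⟩

/-- The map underlying the mediating morphism to a cocone. -/
noncomputable def descFun (s : Cocone (diagram B A)) (a : A) : s.pt :=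
  s.ι.app (single a) (B.finVar (n := 1) 0)

/-- An element `e` of the free algebra over `x` is the image of the generator under a morphism from
the one-element tuple of its value. Naturality along this morphism shows that a cocone is determined
by its values on one-element tuples. -/
theorem cocone_app_apply (s : Cocone (diagram B A)) (x : Tuple B A) (e : B.fin x.n) :
    s.ι.app x e = descFun s (B.finLift x.val e) := by
  let f : single (B.finLift x.val e) ⟶ x := homMk (fun _ => e) fun _ => rfl
  have h := congrArg (fun k => k (B.finVar (n := 1) 0)) (s.w f)
  refine Eq.trans ?_ h
  refine Eq.trans ?_ (BoolAlg.comp_apply _ _ _).symm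
  have hf : f.hom (B.finVar (n := 1) 0) = e := homMk_hom_finVar _ _ _
  exact congrArg (s.ι.app x) hf.symm

theorem cocone_app_finVar (s : Cocone (diagram B A)) (x : Tuple B A) (i : Fin x.n) :
    s.ι.app x (B.finVar i) = descFun s (x.val i) := by
  rw [cocone_app_apply s x (B.finVar i), B.finLift_finVar]

theorem isHom_descFun (s : Cocone (diagram B A)) :
    IsHom (B.str A) (B.str s.pt) (descFun s) := by
  intro o a
  -- All arguments are gathered in one tuple, so that the operation can be applied to the generators
  -- of a single free algebra, where the leg of the cocone is a homomorphism.
  let x : Tuple B A := ⟨_, a⟩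
  have h := cocone_app_apply s x (B.str (B.fin x.n) o fun i => B.finVar i)
  have h₁ : B.finLift x.val (B.str (B.fin x.n) o fun i => B.finVar i) = B.str A o a :=
    (B.isHom (B.finLift x.val) o _).trans
      (congrArg (B.str A o) (funext fun i => B.finLift_finVar _ _))
  rw [h₁] at h
  refine h.symm.trans ((B.isHom (s.ι.app x) o _).trans ?_)
  exact congrArg (B.str s.pt o) (funext fun i => cocone_app_finVar s x i)

variable (B A)

/-- Every Boolean algebra is the colimit of the finitely generated free ones over it. -/
noncomputable def isColimit : IsColimit (cocone B A) where
  desc s := B.homOf (descFun s) (isHom_descFun s)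
  fac s x := BoolAlg.ext fun e =>
    (BoolAlg.comp_apply _ _ _).trans <| (B.homOf_apply _ (isHom_descFun s) _).trans
      (cocone_app_apply s x e).symm
  uniq s k hk := BoolAlg.ext fun a => by
    refine Eq.trans ?_ (B.homOf_apply _ (isHom_descFun s) a).symm
    have h := congrArg (fun k => k (B.finVar (n := 1) 0)) (hk (single a))
    refine Eq.trans ?_ h
    refine Eq.trans ?_ (BoolAlg.comp_apply _ _ _).symm
    exact congrArg k (B.finLift_finVar (fun _ : Fin 1 => a) 0).symm

end Tuple

/-! ### The concrete logic of an abstract logic -/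

namespace AbstractLogic

variable (B : BAPresentation.{u}) {T : Type u ⥤ Type u} (𝓐 : AbstractLogic T)

/-- The `n`-ary modal operators are the elements of `L (F n)`. -/
noncomputable def modalSig : Sig.{u} where
  ops := (n : ℕ) × 𝓐.L.obj (B.fin n)
  ar o := o.1

/-- The variable with a given index. -/
def idxVar (n : ℕ) : Term B.sig (ULift.{u} ℕ) := .var ⟨n⟩

/-- The rank 1 term `♡(t₁, …, tₙ)`. -/
def modalTerm {n : ℕ} (σ : 𝓐.L.obj (B.fin n)) (t : Fin n → Term B.sig (ULift.{u} ℕ)) :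
    RankOne B (𝓐.modalSig B) (ULift.{u} ℕ) :=
  .var ⟨⟨n, σ⟩, t⟩

/-- The equations expressing that `σ ↦ σ(x₁, …, xₙ)` commutes with the Boolean operations, and that
the action of `L` on morphisms is given by substitution. -/
inductive ModalEq :
    RankOne B (𝓐.modalSig B) (ULift.{u} ℕ) × RankOne B (𝓐.modalSig B) (ULift.{u} ℕ) → Prop
  | op (n : ℕ) (o : B.sig.ops) (s : Fin (B.sig.ar o) → 𝓐.L.obj (B.fin n)) :
    ModalEq (𝓐.modalTerm B (B.str (𝓐.L.obj (B.fin n)) o s) (fun i => idxVar B i),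
      .op o fun k => 𝓐.modalTerm B (s k) fun i => idxVar B i)
  | subst (n k : ℕ) (σ : 𝓐.L.obj (B.fin n)) (t : Fin n → Term B.sig (ULift.{u} (Fin k))) :
    ModalEq (𝓐.modalTerm B (𝓐.L.map (B.finLift fun i => B.finMk (t i)) σ) (fun i => idxVar B i),
      𝓐.modalTerm B σ fun i => (t i).subst fun j => idxVar B j.down)

theorem eval_subst_idxVar {A : BoolAlg.{u}} (h : ULift.{u} ℕ → A) {k : ℕ}
    (t : Term B.sig (ULift.{u} (Fin k))) :
    (t.subst fun j => idxVar B j.down).eval (B.str A) h =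
      B.finLift (fun i : Fin k => h ⟨i⟩) (B.finMk t) := by
  rw [Term.eval_subst, B.finLift_finMk]
  rfl

/-- This recasts the equations for the colimit argument: for each tuple `a` the map `σ ↦ m σ a` is a
homomorphism `L (F n) → C`, and these maps are compatible with morphisms between free algebras,
hence form a cocone. -/
theorem modalEq_value_iff {A C : BoolAlg.{u}}
    (m : ∀ o : (𝓐.modalSig B).ops, (Fin ((𝓐.modalSig B).ar o) → A) → C) :
    (∀ e, 𝓐.ModalEq B e → ∀ h : ULift.{u} ℕ → A, e.1.value m h = e.2.value m h) ↔
      (∀ (n : ℕ) (o : B.sig.ops) (s : Fin (B.sig.ar o) → 𝓐.L.obj (B.fin n)) (a : Fin n → A),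
        m ⟨n, B.str (𝓐.L.obj (B.fin n)) o s⟩ a = B.str C o fun k => m ⟨n, s k⟩ a) ∧
      ∀ (n k : ℕ) (σ : 𝓐.L.obj (B.fin n)) (f : B.fin n ⟶ B.fin k) (a : Fin k → A),
        m ⟨k, 𝓐.L.map f σ⟩ a = m ⟨n, σ⟩ fun i => B.finLift a (f (B.finVar i)) := by
  -- The equations use variables indexed by `ℕ`; a finite tuple is padded with `⊥`.
  have ext {n : ℕ} (a : Fin n → A) : ∃ h : ULift.{u} ℕ → A, a = fun i : Fin n => h ⟨i⟩ :=
    ⟨fun k => if hk : k.down < n then a ⟨k.down, hk⟩ else ⊥, by simp⟩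
  constructor
  · intro H
    constructor
    · intro n o s a
      obtain ⟨h, rfl⟩ := ext a
      exact H _ (.op n o s) h
    · intro n k σ f a
      obtain ⟨h, rfl⟩ := ext a
      choose t ht using fun i => B.finMk_surjective (f (B.finVar i))
      have hf : f = B.finLift fun i => B.finMk (t i) :=
        BAPresentation.fin_hom_ext fun i => by rw [B.finLift_finVar, ht]
      have h₁ := H _ (.subst n k σ t) h
      rw [← hf] at h₁
      refine h₁.trans (congrArg (m ⟨n, σ⟩) (funext fun i => ?_))
      exact (eval_subst_idxVar B h (t i)).trans (congrArg _ (ht i))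
  · rintro ⟨h₁, h₂⟩ e (⟨n, o, s⟩ | ⟨n, k, σ, t⟩) h
    · exact h₁ n o s fun i => h ⟨i⟩
    · refine (h₂ n k σ _ fun i => h ⟨i⟩).trans (congrArg (m ⟨n, σ⟩) (funext fun i => ?_))
      refine (congrArg _ (B.finLift_finVar (n := n) _ i)).trans ?_
      exact (eval_subst_idxVar B h (t i)).symm

/-- The generators `L(a)(σ)` of `L A`. -/
noncomputable def modalGen (A : BoolAlg.{u}) (o : (𝓐.modalSig B).ops)
    (a : Fin ((𝓐.modalSig B).ar o) → A) : 𝓐.L.obj A :=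
  𝓐.L.map (B.finLift (n := o.1) a) o.2

theorem map_modalGen {A A' : BoolAlg.{u}} (f : A ⟶ A') (o : (𝓐.modalSig B).ops)
    (a : Fin ((𝓐.modalSig B).ar o) → A) :
    𝓐.L.map f (𝓐.modalGen B A o a) = 𝓐.modalGen B A' o (f ∘ a) := by
  refine (BoolAlg.comp_apply _ _ _).symm.trans ?_
  rw [← 𝓐.L.map_comp]
  exact congrArg (fun k => 𝓐.L.map k o.2) (B.finLift_comp (n := o.1) a f)

theorem modalGen_eqs (e) (he : 𝓐.ModalEq B e) (A : BoolAlg.{u}) (h : ULift.{u} ℕ → A) :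
    e.1.value (𝓐.modalGen B A) h = e.2.value (𝓐.modalGen B A) h := by
  refine (𝓐.modalEq_value_iff B (𝓐.modalGen B A)).2 ⟨fun n o s a => ?_, fun n k σ f a => ?_⟩ e he h
  · exact B.isHom (𝓐.L.map (B.finLift a)) o s
  · refine (BoolAlg.comp_apply _ _ _).symm.trans ?_
    rw [← 𝓐.L.map_comp]
    exact congrArg (fun k => 𝓐.L.map k σ) (BAPresentation.fin_hom_ext fun i =>
      (BoolAlg.comp_apply _ _ _).trans
        (B.finLift_finVar (fun i => B.finLift a (f (B.finVar i))) i).symm)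

/-- The predicate liftings `a ↦ δ(L(a)(σ))`. -/
noncomputable def modalLifting (o : (𝓐.modalSig B).ops) :
    PredicateLifting T ((𝓐.modalSig B).ar o) where
  app X a := 𝓐.δ.app (op X) (𝓐.modalGen B (powerset.obj (op X)) o a)
  natural {X Y} f a := by
    have h := congrArg (fun k => k (𝓐.modalGen B (powerset.obj (op Y)) o a)) (𝓐.δ.naturality f.op)
    refine Eq.trans (congrArg (𝓐.δ.app (op X)) ?_)
      ((BoolAlg.comp_apply _ _ _).symm.trans (h.trans (BoolAlg.comp_apply _ _ _)))
    exact (𝓐.map_modalGen B (powerset.map f.op) o a).symm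

/-- The concrete logic of an abstract logic. -/
noncomputable def toConcrete : ConcreteLogic B T where
  modal := 𝓐.modalSig B
  Var := ULift.{u} ℕ
  eqs := {e | 𝓐.ModalEq B e}
  Δ := 𝓐.modalLifting B
  -- The equations hold in `L P X`, and `δ` at `X` is a Boolean homomorphism into `P T X`.
  sound e he X h := by
    exact (e.1.map_value (𝓐.modalGen B (powerset.obj (op X))) h (𝓐.δ.app (op X))).symm.trans <|
      (congrArg (𝓐.δ.app (op X)) (𝓐.modalGen_eqs B e he (powerset.obj (op X)) h)).trans
        (e.2.map_value (𝓐.modalGen B (powerset.obj (op X))) h (𝓐.δ.app (op X)))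

/-- `L A` as a colimit of algebras `L (F n)`. -/
noncomputable def isColimitMap (A : BoolAlg.{u}) : IsColimit (𝓐.L.mapCocone (Tuple.cocone B A)) :=
  have := 𝓐.sifted (Tuple B A)
  isColimitOfPreserves 𝓐.L (Tuple.isColimit B A)

theorem exists_modal_lift (A C : BoolAlg.{u})
    (m : ∀ o : (𝓐.modalSig B).ops, (Fin ((𝓐.modalSig B).ar o) → A) → C)
    (hm : ∀ e, 𝓐.ModalEq B e → ∀ h : ULift.{u} ℕ → A, e.1.value m h = e.2.value m h) :
    ∃ φ : 𝓐.L.obj A ⟶ C, ∀ o a, φ (𝓐.modalGen B A o a) = m o a := by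
  obtain ⟨h₁, h₂⟩ := (𝓐.modalEq_value_iff B m).1 hm
  have hom (x : Tuple B A) : ∃ k : 𝓐.L.obj (B.fin x.n) ⟶ C, ∀ σ, k σ = m ⟨x.n, σ⟩ x.val :=
    ⟨B.homOf _ fun o s => h₁ x.n o s x.val, B.homOf_apply _ _⟩
  choose k hk using hom
  let s : Cocone (Tuple.diagram B A ⋙ 𝓐.L) :=
    { pt := C
      ι :=
        { app := k
          naturality x y f := BoolAlg.ext fun σ => by
            refine (BoolAlg.comp_apply _ _ _).trans ((hk y _).trans ?_)
            refine Eq.trans ?_ (hk x σ).symm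
            refine (h₂ x.n y.n σ f.hom y.val).trans (congrArg (m ⟨x.n, σ⟩) (funext fun i => ?_))
            exact (Tuple.finLift_hom_apply f _).trans (B.finLift_finVar x.val i) } }
  refine ⟨(𝓐.isColimitMap B A).desc s, fun o a => ?_⟩
  have h := congrArg (fun k => k o.2) ((𝓐.isColimitMap B A).fac s ⟨o.1, a⟩)
  exact (BoolAlg.comp_apply _ _ _).symm.trans (h.trans (hk ⟨o.1, a⟩ o.2))

/-- The generators are precisely the values of the legs of the colimit cocone on `L A`. -/
theorem modal_hom_ext {A C : BoolAlg.{u}} {φ ψ : 𝓐.L.obj A ⟶ C}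
    (h : ∀ o a, φ (𝓐.modalGen B A o a) = ψ (𝓐.modalGen B A o a)) : φ = ψ :=
  (𝓐.isColimitMap B A).hom_ext fun x => BoolAlg.ext fun σ =>
    (BoolAlg.comp_apply _ _ _).trans ((h ⟨x.n, σ⟩ x.val).trans (BoolAlg.comp_apply _ _ _).symm)

/-- The functor of an abstract logic is presented by the operators and equations of its concrete
logic. -/
noncomputable def presentation : Presentation 𝓐 (𝓐.toConcrete B) where
  gen := 𝓐.modalGen B
  map_gen := 𝓐.map_modalGen B
  gen_eqs := 𝓐.modalGen_eqs B
  exists_lift := 𝓐.exists_modal_lift B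
  hom_ext := 𝓐.modal_hom_ext B
  δ_gen _ _ _ := rfl

end AbstractLogic

/-! ### Sifted colimits of sets and finite tuples -/

section Sifted

variable {J : Type u} [SmallCategory J]

theorem ιColimitType_map (K : J ⥤ Type u) {j j' : J} (f : j ⟶ j') (x : K.obj j) :
    K.ιColimitType j' (K.map f x) = K.ιColimitType j x :=
  (Quot.sound ⟨f, rfl⟩).symm

/-- The functor of `n`-tuples. -/
def tuples (K : J ⥤ Type u) (n : ℕ) : J ⥤ Type u where
  obj j := Fin n → K.obj j
  map f := TypeCat.ofHom fun x i => K.map f (x i)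

/-- The class of a tuple in the colimit of the sets of tuples. -/
def tuplesMk (K : J ⥤ Type u) {n : ℕ} (j : J) (x : Fin n → K.obj j) : (tuples K n).ColimitType :=
  (tuples K n).ιColimitType j x

theorem tuplesMk_map (K : J ⥤ Type u) {n : ℕ} {j j' : J} (f : j ⟶ j') (x : Fin n → K.obj j) :
    tuplesMk K j' (fun i => K.map f (x i)) = tuplesMk K j x :=
  ιColimitType_map (tuples K n) f x

variable [IsSifted J]

theorem exists_cospan (j k : J) : ∃ c : J, Nonempty (j ⟶ c) ∧ Nonempty (k ⟶ c) := by
  have := Functor.Final.out (F := Functor.diag J) (j, k)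
  obtain ⟨s⟩ := this.is_nonempty
  exact ⟨s.right, ⟨s.hom.1⟩, ⟨s.hom.2⟩⟩

/-- A compatible family of functions of two variables takes the same value at arguments that agree
in the colimits. -/
theorem eq_of_colimitType_eq₂ {K K' : J ⥤ Type u} {Y : Type u}
    (ψ : ∀ j, K.obj j → K'.obj j → Y)
    (hψ : ∀ {j j' : J} (f : j ⟶ j') (x : K.obj j) (y : K'.obj j),
      ψ j' (K.map f x) (K'.map f y) = ψ j x y)
    {j j' : J} {x : K.obj j} {x' : K.obj j'} {y : K'.obj j} {y' : K'.obj j'}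
    (hx : K.ιColimitType j x = K.ιColimitType j' x')
    (hy : K'.ιColimitType j y = K'.ιColimitType j' y') : ψ j x y = ψ j' x' y' := by
  let val (p : J × J) (x : K.obj p.1) (y : K'.obj p.2)
      (s : StructuredArrow p (Functor.diag J)) : Y :=
    ψ s.right (K.map s.hom.1 x) (K'.map s.hom.2 y)
  -- Finality of the diagonal makes the category of cospans under `p` connected, and `ψ` is
  -- invariant along its morphisms, so the value does not depend on the cospan.
  have conn (p : J × J) (x : K.obj p.1) (y : K'.obj p.2)
      (s s' : StructuredArrow p (Functor.diag J)) : val p x y s = val p x y s' := by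
    have := Functor.Final.out (F := Functor.diag J) p
    refine constant_of_preserves_morphisms (val p x y) (fun s s' r => ?_) s s'
    have h₁ : s'.hom.1 = s.hom.1 ≫ r.right := congrArg Prod.fst (StructuredArrow.w r).symm
    have h₂ : s'.hom.2 = s.hom.2 ≫ r.right := congrArg Prod.snd (StructuredArrow.w r).symm
    dsimp only [val]
    rw [h₁, h₂, K.map_comp, K'.map_comp]
    exact (hψ r.right _ _).symm
  have ne (p : J × J) : Nonempty (StructuredArrow p (Functor.diag J)) :=
    (Functor.Final.out (F := Functor.diag J) p).is_nonempty
  -- This extends `ψ` to arguments at different stages, so that each argument can be moved along the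
  -- diagram separately.
  let Ψ (p : Σ j, K.obj j) (q : Σ j, K'.obj j) : Y := val (p.1, q.1) p.2 q.2 (ne _).some
  have hΨ (p : Σ j, K.obj j) (q : Σ j, K'.obj j) {c : J} (f : p.1 ⟶ c) (g : q.1 ⟶ c) :
      Ψ p q = ψ c (K.map f p.2) (K'.map g q.2) :=
    conn (p.1, q.1) p.2 q.2 _ 
      (StructuredArrow.mk (T := Functor.diag J) (Y := c) (((f, g) : _ × _) : (p.1, q.1) ⟶ (c, c)))
  have step₁ (p p' : Σ j, K.obj j) (q : Σ j, K'.obj j) (h : K.ColimitTypeRel p p') :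
      Ψ p q = Ψ p' q := by
    obtain ⟨f, hf⟩ := h
    obtain ⟨c, ⟨u⟩, ⟨v⟩⟩ := exists_cospan p'.1 q.1
    rw [hΨ p q (f ≫ u) v, hΨ p' q u v, hf, K.map_comp]
    rfl
  have step₂ (p : Σ j, K.obj j) (q q' : Σ j, K'.obj j) (h : K'.ColimitTypeRel q q') :
      Ψ p q = Ψ p q' := by
    obtain ⟨f, hf⟩ := h
    obtain ⟨c, ⟨u⟩, ⟨v⟩⟩ := exists_cospan p.1 q'.1
    rw [hΨ p q u (f ≫ v), hΨ p q' u v, hf, K'.map_comp]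
    rfl
  let F : K.ColimitType → K'.ColimitType → Y :=
    Quot.lift (fun p => Quot.lift (Ψ p) (step₂ p)) fun p p' h => by
      funext q
      induction q using Quot.inductionOn with | _ q => exact step₁ p p' q h
  have hF (j : J) (x : K.obj j) (y : K'.obj j) :
      F (K.ιColimitType j x) (K'.ιColimitType j y) = ψ j x y := by
    refine (hΨ ⟨j, x⟩ ⟨j, y⟩ (𝟙 j) (𝟙 j)).trans ?_
    rw [K.map_id, K'.map_id]
    rfl
  rw [← hF, ← hF, hx, hy]

/-- This is the injectivity half of the commutation of sifted colimits with finite powers. It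
follows by induction, applying the two-variable case to head and tail; empty tuples are compared at
a common later stage. -/
theorem tuplesMk_eq (K : J ⥤ Type u) {n : ℕ} {j j' : J} {x : Fin n → K.obj j}
    {x' : Fin n → K.obj j'} (h : ∀ i, K.ιColimitType j (x i) = K.ιColimitType j' (x' i)) :
    tuplesMk K j x = tuplesMk K j' x' := by
  induction n with
  | zero =>
    obtain ⟨c, ⟨f⟩, ⟨f'⟩⟩ := exists_cospan j j'
    rw [← tuplesMk_map K f, ← tuplesMk_map K f']
    exact congrArg _ (funext fun i => i.elim0)
  | succ n ih =>
    have := eq_of_colimitType_eq₂ (K := K) (K' := tuples K n)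
      (fun j a y => tuplesMk K j (Fin.cons a y : Fin (n + 1) → K.obj j)) (fun {j j'} f a y => by
        refine Eq.trans (congrArg _ (funext fun i => ?_)) (tuplesMk_map K f (Fin.cons a y))
        exact Fin.cases rfl (fun i => rfl) i) (h 0) (ih fun i => h i.succ)
    have hc (j : J) (x : Fin (n + 1) → K.obj j) : Fin.cons (x 0) (fun i => x i.succ) = x :=
      Fin.cons_self_tail x
    rwa [hc, hc] at this

/-- A compatible family of functions on tuples takes the same value at tuples that agree in the
colimit. -/
theorem eq_of_colimitType_eq (K : J ⥤ Type u) {n : ℕ} {Y : Type u}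
    (ψ : ∀ j, (Fin n → K.obj j) → Y)
    (hψ : ∀ {j j' : J} (f : j ⟶ j') (x : Fin n → K.obj j),
      ψ j' (fun i => K.map f (x i)) = ψ j x)
    {j j' : J} {x : Fin n → K.obj j} {x' : Fin n → K.obj j'}
    (h : ∀ i, K.ιColimitType j (x i) = K.ιColimitType j' (x' i)) : ψ j x = ψ j' x' := by
  let F : (tuples K n).ColimitType → Y := Quot.lift (fun p => ψ p.1 p.2) fun p p' ⟨f, hf⟩ => by
    rw [hf]
    exact (hψ f p.2).symm
  exact congrArg F (tuplesMk_eq K h)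

/-- Finitely many elements of a sifted colimit come from one stage. -/
theorem exists_stage {K : J ⥤ Type u} {Y V : Type*} {ι : ∀ j, K.obj j → Y}
    (hι : ∀ {j j' : J} (f : j ⟶ j') (x : K.obj j), ι j' (K.map f x) = ι j x)
    (hs : ∀ y, ∃ j x, ι j x = y) (hK : ∀ j, Nonempty (K.obj j)) (h : V → Y) (l : List V) :
    ∃ (j : J) (x : V → K.obj j), ∀ v ∈ l, ι j (x v) = h v := by
  classical
  induction l with
  | nil =>
    obtain ⟨j⟩ := IsSifted.nonempty (C := J)
    exact ⟨j, fun _ => (hK j).some, by simp⟩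
  | cons w l ih =>
    obtain ⟨j, x, hx⟩ := ih
    obtain ⟨k, y, hy⟩ := hs (h w)
    obtain ⟨c, ⟨f⟩, ⟨g⟩⟩ := exists_cospan j k
    -- The new value overrides the old one if `w` already occurs in `l`; both represent `h w`, so
    -- nothing is lost.
    refine ⟨c, fun v => if v = w then K.map g y else K.map f (x v), fun v hv => ?_⟩
    dsimp only
    by_cases hvw : v = w
    · rw [if_pos hvw, hι, hy, hvw]
    · rw [if_neg hvw, hι]
      exact hx v ((List.mem_cons.1 hv).resolve_left hvw)

theorem exists_stage_tuple {K : J ⥤ Type u} {Y : Type*} {ι : ∀ j, K.obj j → Y}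
    (hι : ∀ {j j' : J} (f : j ⟶ j') (x : K.obj j), ι j' (K.map f x) = ι j x)
    (hs : ∀ y, ∃ j x, ι j x = y) (hK : ∀ j, Nonempty (K.obj j)) {n : ℕ} (a : Fin n → Y) :
    ∃ (j : J) (x : Fin n → K.obj j), a = fun i => ι j (x i) := by
  obtain ⟨j, x, hx⟩ := exists_stage hι hs hK a (List.finRange n)
  exact ⟨j, x, funext fun i => (hx i (List.mem_finRange i)).symm⟩

end Sifted

/-! ### Sifted colimits of Boolean algebras -/

namespace SiftedColimit

variable (B : BAPresentation.{u}) {J : Type u} [SmallCategory J] (D : J ⥤ BoolAlg.{u})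

/-- The underlying sets of a diagram of Boolean algebras. -/
abbrev sets : J ⥤ Type u := D ⋙ forget BoolAlg

/-- The map from a stage to the colimit of the underlying sets. -/
def mk (j : J) (x : D.obj j) : (sets D).ColimitType := (sets D).ιColimitType j x

theorem mk_map {j j' : J} (f : j ⟶ j') (x : D.obj j) : mk D j' (D.map f x) = mk D j x :=
  ιColimitType_map (sets D) f x

theorem mk_surjective (q : (sets D).ColimitType) : ∃ j x, mk D j x = q := by
  induction q using Quot.inductionOn with | _ p => exact ⟨p.1, p.2, rfl⟩

theorem ι_map {D : J ⥤ BoolAlg.{u}} (c : Cocone D) {j j' : J} (f : j ⟶ j')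
    (x : D.obj j) : c.ι.app j' (D.map f x) = c.ι.app j x := by
  rw [← BoolAlg.comp_apply, c.w]

variable [IsSifted J]

theorem exists_rep {n : ℕ} (a : Fin n → (sets D).ColimitType) :
    ∃ (j : J) (x : Fin n → D.obj j), a = fun i => mk D j (x i) :=
  exists_stage_tuple (K := sets D) (mk_map D) (mk_surjective D) (fun j => ⟨(⊥ : D.obj j)⟩) a

/-- The operations on the colimit of the underlying sets. -/
noncomputable def str : Str B.sig (sets D).ColimitType := fun o a =>
  mk D (exists_rep D a).choose (B.str (D.obj _) o (exists_rep D a).choose_spec.choose)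

/-- The operation does not depend on the chosen representatives, because tuples that agree
componentwise in the colimit are identified by every compatible family of functions. -/
theorem str_mk (j : J) (o : B.sig.ops) (x : Fin (B.sig.ar o) → D.obj j) :
    str B D o (fun i => mk D j (x i)) = mk D j (B.str (D.obj j) o x) := by
  have h := (exists_rep D fun i => mk D j (x i)).choose_spec.choose_spec
  refine eq_of_colimitType_eq (sets D) (fun j x => mk D j (B.str (D.obj j) o x))
    (fun {j j'} f x => ?_) fun i => (congrFun h i).symm
  rw [← mk_map D f]
  exact congrArg _ (B.isHom (D.map f) o x).symm

theorem isHom_mk (j : J) : IsHom (B.str (D.obj j)) (str B D) (mk D j) :=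
  fun o x => (str_mk B D j o x).symm

/-- The finitely many variables of an equation can be represented at one stage, where the equation
holds. -/
theorem sat_str : B.toTheory.Sat (str B D) := by
  intro e he h
  obtain ⟨j, x, hx⟩ := exists_stage (K := sets D) (mk_map D) (mk_surjective D)
    (fun j => ⟨(⊥ : D.obj j)⟩) h (e.1.vars ++ e.2.vars)
  have key (t : Term B.sig B.Var) (ht : ∀ v ∈ t.vars, mk D j (x v) = h v) :
      t.eval (str B D) h = mk D j (t.eval (B.str (D.obj j)) x) := by
    rw [(isHom_mk B D j).map_eval]
    exact Term.eval_congr _ t fun v hv => (ht v hv).symm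
  rw [key _ fun v hv => hx v (List.mem_append_left _ hv),
    key _ fun v hv => hx v (List.mem_append_right _ hv)]
  exact congrArg _ (B.sat_str (D.obj j) e he x)

/-- The Boolean algebra on the colimit of the underlying sets. -/
noncomputable def pt : BoolAlg.{u} := B.ofStr (str B D) (sat_str B D)

theorem exists_ι (j : J) : ∃ k : D.obj j ⟶ pt B D, ∀ x, k x = mk D j x := by
  have h : IsHom (B.str (D.obj j)) (B.str (pt B D)) (mk D j) := by
    rw [show B.str (pt B D) = str B D from B.str_ofStr _ _]
    exact isHom_mk B D j
  exact ⟨B.homOf (Y := pt B D) (mk D j) h, B.homOf_apply (Y := pt B D) (mk D j) h⟩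

variable {D} (c : Cocone D)

/-- The map from the colimit of the underlying sets to a cocone. -/
def descFun : (sets D).ColimitType → c.pt :=
  Quot.lift (fun p => c.ι.app p.1 p.2) fun p p' ⟨f, hf⟩ => by
    rw [hf]
    exact (ι_map c f p.2).symm

theorem exists_desc : ∃ k : pt B D ⟶ c.pt, ∀ j (x : D.obj j), k (mk D j x) = c.ι.app j x := by
  have h : IsHom (B.str (pt B D)) (B.str c.pt) (descFun c) := by
    rw [show B.str (pt B D) = str B D from B.str_ofStr _ _]
    intro o a
    obtain ⟨j, x, rfl⟩ := exists_rep D a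
    rw [str_mk]
    exact B.isHom (c.ι.app j) o x
  exact ⟨B.homOf (X := pt B D) (descFun c) h, fun j x =>
    B.homOf_apply (X := pt B D) (descFun c) h (mk D j x)⟩

variable {c}

/-- This transfers facts about the colimit of sets to an arbitrary colimit cocone in Boolean
algebras. -/
theorem exists_comparison (hc : IsColimit c) :
    ∃ k : c.pt ⟶ pt B D, ∀ j (x : D.obj j), k (c.ι.app j x) = mk D j x := by
  choose ι hι using exists_ι B D
  let s : Cocone D :=
    { pt := pt B D
      ι :=
        { app := ι
          naturality j j' f := BoolAlg.ext fun x =>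
            (BoolAlg.comp_apply _ _ _).trans <| (hι j' _).trans <|
              (mk_map D f x).trans (hι j x).symm } }
  refine ⟨hc.desc s, fun j x => ?_⟩
  rw [← BoolAlg.comp_apply, hc.fac]
  exact hι j x

theorem mk_eq_of_ι_eq (B : BAPresentation.{u}) (hc : IsColimit c) {j j' : J}
    {x : D.obj j} {x' : D.obj j'} (h : c.ι.app j x = c.ι.app j' x') : mk D j x = mk D j' x' := by
  obtain ⟨k, hk⟩ := exists_comparison B hc
  rw [← hk, ← hk, h]

theorem ι_surjective (B : BAPresentation.{u}) (hc : IsColimit c) (a : c.pt) :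
    ∃ j, ∃ x : D.obj j, c.ι.app j x = a := by
  obtain ⟨k, hk⟩ := exists_comparison B hc
  obtain ⟨l, hl⟩ := exists_desc B c
  obtain ⟨j, x, hx⟩ := mk_surjective D (k a)
  -- Every element of the colimit is `l` of its image under `k`, and that image comes from a stage.
  have h : k ≫ l = 𝟙 _ := hc.hom_ext fun j => BoolAlg.ext fun x => by
    rw [BoolAlg.comp_apply, BoolAlg.comp_apply, hk, hl, Category.comp_id]
  refine ⟨j, x, ?_⟩
  rw [← hl, hx]
  exact (BoolAlg.comp_apply _ _ _).symm.trans (congrArg (fun k => k a) h)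

end SiftedColimit

/-- The variables occurring in a rank 1 term, as a list. -/
def RankOne.vars {B : BAPresentation.{u}} {S : Sig.{u}} {V : Type u} (t : RankOne B S V) :
    List V :=
  (Term.vars t).flatMap fun q => (List.ofFn fun i => (q.2 i).vars).flatten

theorem RankOne.value_congr {B : BAPresentation.{u}} {S : Sig.{u}} {V : Type u}
    {A C : BoolAlg.{u}} (m : ∀ o : S.ops, (Fin (S.ar o) → A) → C) {h h' : V → A}
    (t : RankOne B S V) (hh : ∀ v ∈ t.vars, h v = h' v) : t.value m h = t.value m h' := by
  refine Term.eval_congr _ t fun q hq => congrArg (m q.1) (funext fun i => ?_)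
  refine Term.eval_congr _ _ fun v hv => hh v (List.mem_flatMap.2 ⟨q, hq, ?_⟩)
  exact List.mem_flatten.2 ⟨_, (List.mem_ofFn' _ _).2 ⟨i, rfl⟩, hv⟩

/-! ### The abstract logic of a concrete logic -/

namespace ConcreteLogic

variable {B : BAPresentation.{u}} {T : Type u ⥤ Type u} (𝓒 : ConcreteLogic B T)

/-- The formal expressions `♡(a₁, …, aₙ)` with `aᵢ` in a Boolean algebra. -/
abbrev Modal (A : BoolAlg.{u}) : Type u := (o : 𝓒.modal.ops) × (Fin (𝓒.modal.ar o) → A)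

/-- A rank 1 term as a term in the formal expressions `♡(a₁, …, aₙ)`. -/
def instantiate {A : BoolAlg.{u}} (h : 𝓒.Var → A) (t : RankOne B 𝓒.modal 𝓒.Var) :
    Term B.sig (𝓒.Modal A) :=
  t.subst fun q => .var ⟨q.1, fun i => (q.2 i).eval (B.str A) h⟩

/-- The instances of the equations in a Boolean algebra. -/
def Rel (A : BoolAlg.{u}) (r r' : Term B.sig (𝓒.Modal A)) : Prop :=
  ∃ e ∈ 𝓒.eqs, ∃ h : 𝓒.Var → A, r = 𝓒.instantiate h e.1 ∧ r' = 𝓒.instantiate h e.2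

/-- The algebra generated by the expressions `♡(a₁, …, aₙ)` subject to the equations. -/
noncomputable def objAlg (A : BoolAlg.{u}) : Alg B.toTheory := B.toTheory.pres (𝓒.Rel A)

/-- The Boolean algebra generated by the expressions `♡(a₁, …, aₙ)` subject to the equations. -/
noncomputable def obj (A : BoolAlg.{u}) : BoolAlg.{u} := B.ofStr (𝓒.objAlg A).str (𝓒.objAlg A).sat

theorem str_obj (A : BoolAlg.{u}) : B.str (𝓒.obj A) = (𝓒.objAlg A).str := B.str_ofStr _ _

/-- The generator `♡(a₁, …, aₙ)`. -/
noncomputable def gen (A : BoolAlg.{u}) (o : 𝓒.modal.ops) (a : Fin (𝓒.modal.ar o) → A) : 𝓒.obj A :=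
  B.toTheory.presGen (𝓒.Rel A) ⟨o, a⟩

theorem eval_instantiate {A C : BoolAlg.{u}} (m : ∀ o, (Fin (𝓒.modal.ar o) → A) → C)
    (h : 𝓒.Var → A) (t : RankOne B 𝓒.modal 𝓒.Var) :
    (𝓒.instantiate h t).eval (B.str C) (fun q => m q.1 q.2) = t.value m h :=
  Term.eval_subst _ _ _ _

theorem gen_eqs (e) (he : e ∈ 𝓒.eqs) (A : BoolAlg.{u}) (h : 𝓒.Var → A) :
    e.1.value (𝓒.gen A) h = e.2.value (𝓒.gen A) h := by
  rw [← eval_instantiate, ← eval_instantiate, str_obj]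
  exact B.toTheory.pres_rel (𝓒.Rel A) ⟨e, he, h, rfl, rfl⟩

theorem exists_lift (A C : BoolAlg.{u}) (m : ∀ o, (Fin (𝓒.modal.ar o) → A) → C)
    (hm : ∀ e ∈ 𝓒.eqs, ∀ h : 𝓒.Var → A, e.1.value m h = e.2.value m h) :
    ∃ φ : 𝓒.obj A ⟶ C, ∀ o a, φ (𝓒.gen A o a) = m o a := by
  let k := B.toTheory.presLift (𝓒.Rel A) (B.toAlg C) (fun q => m q.1 q.2) (by
    rintro _ _ ⟨e, he, h, rfl, rfl⟩
    exact (𝓒.eval_instantiate m h e.1).trans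
      ((hm e he h).trans (𝓒.eval_instantiate m h e.2).symm))
  have hk : IsHom (B.str (𝓒.obj A)) (B.str C) k.toFun := by
    rw [str_obj]
    exact k.isHom
  exact ⟨B.homOf (X := 𝓒.obj A) k.toFun hk, fun o a =>
    B.homOf_apply (X := 𝓒.obj A) k.toFun hk (𝓒.gen A o a)⟩

variable {𝓒}

theorem hom_ext {A C : BoolAlg.{u}} {φ ψ : 𝓒.obj A ⟶ C}
    (h : ∀ o a, φ (𝓒.gen A o a) = ψ (𝓒.gen A o a)) : φ = ψ := by
  have hφ := B.isHom φ
  have hψ := B.isHom ψ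
  rw [str_obj] at hφ hψ
  exact BoolAlg.ext (congrFun (hφ.pres_ext hψ fun q => h q.1 q.2))

variable (𝓒)

theorem exists_map {A A' : BoolAlg.{u}} (f : A ⟶ A') :
    ∃ φ : 𝓒.obj A ⟶ 𝓒.obj A', ∀ o a, φ (𝓒.gen A o a) = 𝓒.gen A' o (f ∘ a) :=
  𝓒.exists_lift A _ (fun o a => 𝓒.gen A' o (f ∘ a)) fun e he h => by
    rw [← RankOne.value_comp, ← RankOne.value_comp]
    exact 𝓒.gen_eqs e he A' _

/-- The action of the functor presented by the modal operators and the equations. -/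
noncomputable def map {A A' : BoolAlg.{u}} (f : A ⟶ A') : 𝓒.obj A ⟶ 𝓒.obj A' :=
  (𝓒.exists_map f).choose

@[simp]
theorem map_gen {A A' : BoolAlg.{u}} (f : A ⟶ A') (o : 𝓒.modal.ops)
    (a : Fin (𝓒.modal.ar o) → A) : 𝓒.map f (𝓒.gen A o a) = 𝓒.gen A' o (f ∘ a) :=
  (𝓒.exists_map f).choose_spec o a

/-- The functor presented by the modal operators and the equations. -/
noncomputable def functor : BoolAlg.{u} ⥤ BoolAlg.{u} where
  obj := 𝓒.obj
  map := 𝓒.map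
  map_id A := hom_ext fun o a => by rw [map_gen]; rfl
  map_comp f g := hom_ext fun o a => by
    rw [BoolAlg.comp_apply, map_gen, map_gen, map_gen]
    rfl

/-! ### Preservation of sifted colimits by the presented functor -/

section Sifted

variable {J : Type u} [SmallCategory J] {D : J ⥤ BoolAlg.{u}} {c : Cocone D}

theorem cocone_app_map_gen (s : Cocone (D ⋙ 𝓒.functor)) {j j' : J} (f : j ⟶ j')
    (o : 𝓒.modal.ops) (x : Fin (𝓒.modal.ar o) → D.obj j) :
    s.ι.app j' (𝓒.gen (D.obj j') o (D.map f ∘ x)) = s.ι.app j (𝓒.gen (D.obj j) o x) := by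
  rw [← 𝓒.map_gen]
  exact SiftedColimit.ι_map s f (𝓒.gen (D.obj j) o x)

variable [IsSifted J]

theorem exists_rep_tuple (B : BAPresentation.{u}) (hc : IsColimit c) {n : ℕ} (a : Fin n → c.pt) :
    ∃ (j : J) (x : Fin n → D.obj j), a = c.ι.app j ∘ x :=
  exists_stage_tuple (K := SiftedColimit.sets D) (SiftedColimit.ι_map c)
    (SiftedColimit.ι_surjective B hc) (fun j => ⟨(⊥ : D.obj j)⟩) a

/-- The value on a generator `♡(a₁, …, aₙ)` over the colimit is computed at a stage where all `aᵢ`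
are represented. By siftedness this is independent of the stage, and the equations hold because they
hold at a stage. -/
theorem exists_desc (hc : IsColimit c) (s : Cocone (D ⋙ 𝓒.functor)) :
    ∃ k : 𝓒.obj c.pt ⟶ s.pt, ∀ j o (x : Fin (𝓒.modal.ar o) → D.obj j),
      k (𝓒.gen c.pt o (c.ι.app j ∘ x)) = s.ι.app j (𝓒.gen (D.obj j) o x) := by
  choose st rep hrep using fun (o : 𝓒.modal.ops) (a : Fin (𝓒.modal.ar o) → c.pt) =>
    exists_rep_tuple B hc a
  let m (o : 𝓒.modal.ops) (a : Fin (𝓒.modal.ar o) → c.pt) : s.pt :=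
    s.ι.app (st o a) (𝓒.gen (D.obj (st o a)) o (rep o a))
  have hm (j : J) (o : 𝓒.modal.ops) (x : Fin (𝓒.modal.ar o) → D.obj j) :
      m o (c.ι.app j ∘ x) = s.ι.app j (𝓒.gen (D.obj j) o x) := by
    let ψ (j : J) (x : Fin (𝓒.modal.ar o) → (SiftedColimit.sets D).obj j) : s.pt :=
      s.ι.app j (𝓒.gen (D.obj j) o x)
    exact eq_of_colimitType_eq (SiftedColimit.sets D) ψ
      (fun f x => 𝓒.cocone_app_map_gen s f o x)
      fun i => SiftedColimit.mk_eq_of_ι_eq B hc (congrFun (hrep o (c.ι.app j ∘ x)) i).symm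
  obtain ⟨k, hk⟩ := 𝓒.exists_lift c.pt s.pt m fun e he h => by
    obtain ⟨j, x, hx⟩ := exists_stage (K := SiftedColimit.sets D) (SiftedColimit.ι_map c)
      (SiftedColimit.ι_surjective B hc) (fun j => ⟨(⊥ : D.obj j)⟩) h (e.1.vars ++ e.2.vars)
    have key (t : RankOne B 𝓒.modal 𝓒.Var) (ht : ∀ v ∈ t.vars, c.ι.app j (x v) = h v) :
        t.value m h = s.ι.app j (t.value (𝓒.gen (D.obj j)) x) := by
      refine (t.value_congr m (h' := c.ι.app j ∘ x) fun v hv => (ht v hv).symm).trans ?_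
      refine (t.value_comp m x (c.ι.app j)).trans ?_
      refine Eq.trans ?_ (t.map_value (𝓒.gen (D.obj j)) x (s.ι.app j)).symm
      -- By `hm`, composing `m` with the leg at `j` gives the leg of `s` on generators at `j`.
      exact congrArg (fun m => t.value m x) (funext fun o => funext fun a => hm j o a)
    rw [key _ fun v hv => hx v (List.mem_append_left _ hv),
      key _ fun v hv => hx v (List.mem_append_right _ hv)]
    exact congrArg (s.ι.app j) (𝓒.gen_eqs e he (D.obj j) x)
  exact ⟨k, fun j o x => (hk _ _).trans (hm j o x)⟩

theorem preservesSiftedColimits : PreservesColimitsOfShape J 𝓒.functor where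
  preservesColimit {D} :=
    { preserves {c} hc := by
        choose k hk using 𝓒.exists_desc hc
        exact ⟨
          { desc := k
            fac s j := hom_ext fun o a =>
              (BoolAlg.comp_apply _ _ _).trans <|
                (congrArg (k s) (𝓒.map_gen (c.ι.app j) o a)).trans (hk s j o a)
            uniq s l hl := hom_ext fun o a => by
              obtain ⟨j, x, rfl⟩ := exists_rep_tuple B hc a
              rw [hk, ← hl]
              refine Eq.trans ?_ (BoolAlg.comp_apply _ _ _).symm
              exact congrArg l (𝓒.map_gen (c.ι.app j) o x).symm }⟩ }

end Sifted

/-- Soundness of the equations for the predicate liftings is exactly the hypothesis of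
`exists_lift`. -/
theorem exists_delta (X : Type u) :
    ∃ d : 𝓒.obj (powerset.obj (op X)) ⟶ powerset.obj (op (T.obj X)),
      ∀ o a, d (𝓒.gen _ o a) = (𝓒.Δ o).app X a :=
  𝓒.exists_lift (powerset.obj (op X)) (powerset.obj (op (T.obj X)))
    (fun o a => (𝓒.Δ o).app X a) fun e he h => 𝓒.sound e he X h

/-- The component `LPX → PTX` given by the predicate liftings. -/
noncomputable def delta (X : Type u) :
    𝓒.obj (powerset.obj (op X)) ⟶ powerset.obj (op (T.obj X)) :=
  (𝓒.exists_delta X).choose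

theorem delta_gen (X : Type u) (o : 𝓒.modal.ops) (a : Fin (𝓒.modal.ar o) → Set X) :
    𝓒.delta X (𝓒.gen (powerset.obj (op X)) o a) = (𝓒.Δ o).app X a :=
  (𝓒.exists_delta X).choose_spec o a

/-- On generators this is the naturality of the predicate liftings. -/
theorem delta_natural {X Y : Type u} (f : X ⟶ Y) :
    𝓒.map (powerset.map f.op) ≫ 𝓒.delta X = 𝓒.delta Y ≫ powerset.map (T.map f).op :=
  hom_ext fun o a => by
    rw [BoolAlg.comp_apply, BoolAlg.comp_apply, map_gen]
    refine (𝓒.delta_gen X o _).trans (((𝓒.Δ o).natural f a).trans ?_)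
    exact congrArg (powerset.map (T.map f).op) (𝓒.delta_gen Y o a).symm

/-- The abstract logic of a concrete logic. -/
noncomputable def toAbstract : AbstractLogic T where
  L := 𝓒.functor
  sifted _ _ _ := 𝓒.preservesSiftedColimits
  δ :=
    { app X := 𝓒.delta X.unop
      naturality _ _ f := 𝓒.delta_natural f.unop }

/-- The functor of the abstract logic of a concrete logic is presented by its operators and
equations. -/
noncomputable def presentation : Presentation 𝓒.toAbstract 𝓒 where
  gen := 𝓒.gen
  map_gen := 𝓒.map_gen
  gen_eqs := 𝓒.gen_eqs
  exists_lift := 𝓒.exists_lift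
  hom_ext := hom_ext
  δ_gen := 𝓒.delta_gen

end ConcreteLogic

end CoalgLogic

theorem mainTheorem4 (B : CoalgLogic.BAPresentation.{u})
    (T : CategoryTheory.Functor (Type u) (Type u)) :
    (∀ A : CoalgLogic.AbstractLogic T, ∃ C : CoalgLogic.ConcreteLogic B T,
      CoalgLogic.Equivalent A C) ∧
    (∀ C : CoalgLogic.ConcreteLogic B T, ∃ A : CoalgLogic.AbstractLogic T,
      CoalgLogic.Equivalent A C) :=
  ⟨fun A => ⟨A.toConcrete B, (A.presentation B).equivalent⟩,
    fun C => ⟨C.toAbstract, C.presentation.equivalent⟩⟩
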